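/- **Setting.** The notions of sc-smooth calculus are those of Hofer, Wysocki and Zehnder, in the version based on splicings: sc-Banach spaces, sc-smooth maps, M-polyfolds (second countable paracompact Hausdorff spaces locally homeomorphic to open subsets of splicing cores, with sc-smooth transition maps), ep-groupoids (étale proper groupoids in M-polyfolds) and strong bundles over them. Let $X$ be an ep-groupoid with object space $X$ and morphism space $\mathbf X$, and let $P:E\to X$ be a strong bundle over $X$; its fibers are vector spaces $E_x$, and a morphism $g:x\to y$ acts by a linear isomorphism $\mu(g,\cdot):E_x\to E_y$. Assume that the sc-structures are based on separable Hilbert spaces, that is, the local models of $X$ and of $E$ (base and fibers) are built on sc-Banach spaces all of whose levels are separable Hilbert spaces. Let $E_{0,1}\subset E$ be the set of vectors of fiber regularity $1$. An *auxiliary norm* is a continuous map $N^*:E_{0,1}\to[0,\infty)$ with the following properties. (a) It restricts to a complete norm on each fiber of $E_{0,1}$. (b) If $y_k\to y$ in the mixed sense (the base points converge in $X$, and in a bundle chart the fiber components converge weakly in the level-one space of the fiber), then $N^*(y)\le\liminf_k N^*(y_k)$. (c) If $N^*(y_k)$ is bounded and $P(y_k)$ converges in $X$ to a point $x$, then $(y_k)$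 has a subsequence converging in the mixed sense to a point over $x$. (d) $N^*(\mu(g,e))=N^*(e)$ for all $e \in E_{0,1}$ and all morphisms $g$ starting at $P(e)$. An *$\mathrm{sc}^+$-multisection* of $P$ is a map $\Lambda:E\to\mathbb Q\cap[0,\infty)$ such that $\Lambda(\mu(g,e))=\Lambda(e)$ for all $e\in E$ and all morphisms $g$ starting at $P(e)$, and such that every $x\in X$ has an open neighborhood $U_x$, on which the isotropy group of $x$ acts by its natural representation, together with finitely many $\mathrm{sc}^+$-sections $s_1,\dots,s_k$ of $E$ over $U_x$ (sc-smooth as maps into $E^{0,1}$, where $(E^{0,1})_m=E_{m,m+1}$) and positive rational numbers $\sigma_1,\dots,\sigma_k$ with $\sum_j\sigma_j=1$ and $\Lambda(e)=\sum_{\{j\,:\,s_j(P(e))=e\}}\sigma_j$ for all $e\in E$ with $P(e)\in U_x$ (an empty sum being $0$). The *support* of $\Lambda$ is the smallest closed subset of $X$ outside of which $\Lambda$ is trivial, that is, $\Lambda(0_x)=1$ for all $x$ outside of it. A set $U\subset X$ is *saturated* if it contains with an object $x$ every object $y$ for which there is a morphism $x\to y$. **Theorem.** Let $P:E\to X$ be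 as above, let $N^*$ be an auxiliary norm for $P$, let $e\in E$ be a smooth point, let $U\subset X$ be a saturated open neighborhood of $P(e)$, and let $\varepsilon\in\mathbb R$. Then there exists an $\mathrm{sc}^+$-multisection $\Lambda:E\to\mathbb Q\cap[0,\infty)$ of $P$ with support contained in $U$ (in particular $\Lambda$ is trivial on $X\setminus U$) and $\Lambda(e)>0$. Moreover, if $N^*(e)<\varepsilon$, then $\Lambda$ can be chosen such that every $h\in E$ with $\Lambda(h)>0$ lies in $E_{0,1}$ and satisfies $N^*(h)<\varepsilon$. -/

import Mathlib

open CategoryTheory Filter Topology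
open scoped NNReal ENNReal

universe u v w z

namespace Polyfold

/-! ## Sc-Banach spaces -/

/-- An sc-Banach space: a Banach space `E = E₀` with an sc-smooth structure
`E₀ ⊇ E₁ ⊇ E₂ ⊇ ⋯`, where `E_m` is the Banach space `lvl m`. The inclusions `E_{m+1} → E_m` are
compact, and `E_∞ = ⋂ E_m` is dense in every `E_m`; an element of `E_∞` is a coherent sequence. -/
structure ScBanach : Type (u + 1) where
  lvl : ℕ → Type u
  [nacg : ∀ m, NormedAddCommGroup (lvl m)]
  [nsp : ∀ m, NormedSpace ℝ (lvl m)]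
  [cpl : ∀ m, CompleteSpace (lvl m)]
  incl : ∀ m, lvl (m + 1) →L[ℝ] lvl m
  incl_injective : ∀ m, Function.Injective (incl m)
  incl_compact : ∀ m, IsCompactOperator (incl m)
  dense : ∀ m, Dense {x : lvl m | ∃ s : ∀ n, lvl n, (∀ n, incl n (s (n + 1)) = s n) ∧ s m = x}

attribute [instance] ScBanach.nacg ScBanach.nsp ScBanach.cpl

namespace ScBanach

/-- The inclusion `E_m → E₀`. -/
noncomputable def emb (E : ScBanach.{u}) : ∀ m, E.lvl m →L[ℝ] E.lvl 0
  | 0 => ContinuousLinearMap.id ℝ (E.lvl 0)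
  | m + 1 => (E.emb m).comp (E.incl m)

/-- The sc-Banach space `E¹`, with levels `(E¹)_m = E_{m+1}`. -/
@[reducible] noncomputable def shift (E : ScBanach.{u}) : ScBanach.{u} where
  lvl m := E.lvl (m + 1)
  incl m := E.incl (m + 1)
  incl_injective m := E.incl_injective (m + 1)
  incl_compact m := E.incl_compact (m + 1)
  dense m := (E.dense (m + 1)).mono (by
    rintro x ⟨s, hs, rfl⟩
    exact ⟨fun n => s (n + 1), fun n => hs (n + 1), rfl⟩)

/-- The direct sum `E ⊕ F`, with levels `E_m ⊕ F_m`. -/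
@[reducible] noncomputable def prod (E F : ScBanach.{u}) : ScBanach.{u} where
  lvl m := E.lvl m × F.lvl m
  incl m := (E.incl m).prodMap (F.incl m)
  incl_injective m := (E.incl_injective m).prodMap (F.incl_injective m)
  incl_compact m := by
    obtain ⟨K, hK, hK'⟩ := E.incl_compact m
    obtain ⟨L, hL, hL'⟩ := F.incl_compact m
    exact ⟨K ×ˢ L, hK.prod hL, mem_of_superset (prod_mem_nhds hK' hL') fun _ hx => hx⟩
  dense m := ((E.dense m).prod (F.dense m)).mono (by
    rintro ⟨x, y⟩ ⟨⟨s, hs, rfl⟩, ⟨t, ht, rfl⟩⟩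
    exact ⟨fun n => (s n, t n), fun n => Prod.ext (hs n) (ht n), rfl⟩)

/-- The tangent `TE = E¹ ⊕ E`. -/
@[reducible] noncomputable def tangent (E : ScBanach.{u}) : ScBanach.{u} := E.shift.prod E

/-- Every level is separable, and is a Hilbert space up to an equivalent norm. -/
def IsSeparableHilbert (E : ScBanach.{u}) : Prop :=
  ∀ m, TopologicalSpace.SeparableSpace (E.lvl m) ∧
    ∃ (H : Type u) (_ : NormedAddCommGroup H) (_ : InnerProductSpace ℝ H),
      Nonempty (E.lvl m ≃L[ℝ] H)

/-- `C` is a partial quadrant of `W`: for some sc-isomorphism `T : W → ℝⁿ ⊕ W'`, it is the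
preimage of `[0,∞)ⁿ ⊕ W'`. -/
def IsPartialQuadrant (W : ScBanach.{u}) (C : Set (W.lvl 0)) : Prop :=
  ∃ (n : ℕ) (W' : ScBanach.{u}) (T : ∀ m, W.lvl m ≃L[ℝ] (Fin n → ℝ) × W'.lvl m),
    (∀ m x, T m (W.incl m x) = ((T (m + 1) x).1, W'.incl m (T (m + 1) x).2)) ∧
      C = {x | ∀ i, 0 ≤ (T 0 x).1 i}

end ScBanach

/-! ## Sc-smooth maps -/

/-- `f : U → F` is sc-continuous: for every `m` it restricts to a continuous map
`U ∩ E_m → F_m`. Values of `f` outside `U` are irrelevant, here and below. -/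
def IsSc0 {E F : ScBanach.{u}} (U : Set (E.lvl 0)) (f : E.lvl 0 → F.lvl 0) : Prop :=
  ∀ m, ∃ fm : E.lvl m → F.lvl m,
    (∀ x, E.emb m x ∈ U → F.emb m (fm x) = f (E.emb m x)) ∧
      ContinuousOn fm {x | E.emb m x ∈ U}

/-- `f : U → F` is of class sc^n. It is of class sc^(n+1) if it is sc-continuous, if at every
`x ∈ U ∩ E₁` there is `Df(x) ∈ L(E₀, F₀)` with
`‖f(x+h) - f(x) - Df(x)h‖₀ / ‖h‖₁ → 0` as `h → 0` in `E₁`, `x + h ∈ U`, and if the tangent map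
`Tf(x,h) = (f(x), Df(x)h)` from `TU = (U ∩ E₁) ⊕ E₀` to `TF = F¹ ⊕ F` is of class sc^n.
The map `f₁` is the restriction of `f` to level one. -/
def IsSc : ℕ → ∀ {E F : ScBanach.{u}}, Set (E.lvl 0) → (E.lvl 0 → F.lvl 0) → Prop
  | 0, _, _, U, f => IsSc0 U f
  | n + 1, E, F, U, f => IsSc0 U f ∧
      ∃ (f₁ : E.lvl 1 → F.lvl 1) (D : E.lvl 1 → E.lvl 0 →L[ℝ] F.lvl 0),
        (∀ x, E.incl 0 x ∈ U → F.incl 0 (f₁ x) = f (E.incl 0 x)) ∧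
        (∀ x, E.incl 0 x ∈ U → HasFDerivWithinAt (fun y : E.lvl 1 => f (E.incl 0 y))
          ((D x).comp (E.incl 0)) {y | E.incl 0 y ∈ U} x) ∧
        IsSc n (E := E.tangent) (F := F.tangent) {p | E.incl 0 p.1 ∈ U}
          (fun p => (f₁ p.1, D p.1 p.2))

/-- `f : U → F` is sc-smooth. -/
def IsScSmooth {E F : ScBanach.{u}} (U : Set (E.lvl 0)) (f : E.lvl 0 → F.lvl 0) : Prop :=
  ∀ n, IsSc n U f

/-! ## Splicings and M-polyfolds -/

/-- An sc-smooth splicing `(π, E, V)`: `V` is a relatively open subset of a partial quadrant `C` of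
`W`, and `π_v`, `v ∈ V`, are bounded linear projections of `E` such that `(v,e) ↦ π_v(e)` is
sc-smooth on `V ⊕ E`. -/
structure Splicing : Type (u + 1) where
  W : ScBanach.{u}
  E : ScBanach.{u}
  C : Set (W.lvl 0)
  quadrant : W.IsPartialQuadrant C
  V : Set (W.lvl 0)
  V_open : ∃ O, IsOpen O ∧ V = O ∩ C
  π : W.lvl 0 → E.lvl 0 →L[ℝ] E.lvl 0
  idem : ∀ v ∈ V, ∀ e, π v (π v e) = π v e
  smooth : IsScSmooth (E := W.prod E) (F := E) {p | p.1 ∈ V} (fun p => π p.1 p.2)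

namespace Splicing

/-- The ambient space `W ⊕ E`. -/
@[reducible] noncomputable def amb (S : Splicing.{u}) : ScBanach.{u} := S.W.prod S.E

/-- The retraction `(v,e) ↦ (v, π_v(e))` of `V ⊕ E` onto the splicing core. -/
noncomputable def ret (S : Splicing.{u}) (p : S.amb.lvl 0) : S.amb.lvl 0 := (p.1, S.π p.1 p.2)

/-- The splicing core `K = {(v,e) ∈ V ⊕ E | π_v(e) = e}`. -/
def core (S : Splicing.{u}) : Set (S.amb.lvl 0) := {p | p.1 ∈ S.V ∧ S.π p.1 p.2 = p.2}

end Splicing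

/-- A chart of `X`: a homeomorphism `φ` from an open subset of `X` onto an open subset of a
splicing core. -/
structure MPChart (X : Type v) [TopologicalSpace X] : Type (max v (u + 1)) where
  S : Splicing.{u}
  φ : PartialEquiv X (S.amb.lvl 0)
  open_source : IsOpen φ.source
  open_target : ∃ O, IsOpen O ∧ φ.target = O ∩ S.core
  cont : ContinuousOn φ φ.source
  cont_symm : ContinuousOn φ.symm φ.target

namespace MPChart

variable {X : Type v} [TopologicalSpace X]

/-- The set of all `q ∈ V ⊕ E` whose image under the retraction onto the splicing core corresponds
to a point of `A` in the chart. A map on (an open part of) a splicing core is sc-smooth if its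
composition with the retraction is sc-smooth on the preimage under the retraction. -/
def pull (c : MPChart.{u} X) (A : Set X) : Set (c.S.amb.lvl 0) :=
  {q | q.1 ∈ c.S.V ∧ c.S.ret q ∈ c.φ.target ∧ c.φ.symm (c.S.ret q) ∈ A}

/-- The transition map from the chart `c` to the chart `d` is sc-smooth. -/
def Transition (c d : MPChart.{u} X) : Prop :=
  IsScSmooth (E := c.S.amb) (F := d.S.amb) (c.pull d.φ.source)
    (fun q => d.φ (c.φ.symm (c.S.ret q)))

end MPChart

/-- An M-polyfold structure on `X`, given by an atlas. -/
structure MPolyfold (X : Type v) [TopologicalSpace X] : Type (max v (u + 1)) where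
  t2 : T2Space X
  second_countable : SecondCountableTopology X
  paracompact : ParacompactSpace X
  atlas : Set (MPChart.{u} X)
  cover : ∀ x, ∃ c ∈ atlas, x ∈ c.φ.source
  compat : ∀ c ∈ atlas, ∀ d ∈ atlas, c.Transition d

namespace MPolyfold

variable {X : Type v} {Y : Type w} [TopologicalSpace X] [TopologicalSpace Y]

/-- `f` is sc-smooth on the open set `U`. -/
def ScSmoothOn (M : MPolyfold.{u} X) (N : MPolyfold.{u} Y) (U : Set X) (f : X → Y) : Prop :=
  ContinuousOn f U ∧ ∀ c ∈ M.atlas, ∀ d ∈ N.atlas,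
    IsScSmooth (E := c.S.amb) (F := d.S.amb) (c.pull (U ∩ f ⁻¹' d.φ.source))
      (fun q => d.φ (f (c.φ.symm (c.S.ret q))))

/-- `f` is a local sc-diffeomorphism. -/
def IsLocalScDiffeo (M : MPolyfold.{u} X) (N : MPolyfold.{u} Y) (f : X → Y) : Prop :=
  ∀ x, ∃ e : OpenPartialHomeomorph X Y, x ∈ e.source ∧ Set.EqOn f e e.source ∧
    M.ScSmoothOn N e.source e ∧ N.ScSmoothOn M e.target e.symm

/-- The charts of the atlas are modelled on separable sc-Hilbert spaces. -/
def IsSeparableHilbert (M : MPolyfold.{u} X) : Prop :=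
  ∀ c ∈ M.atlas, c.S.W.IsSeparableHilbert ∧ c.S.E.IsSeparableHilbert

end MPolyfold

/-! ## Ep-groupoids -/

/-- The set of all morphisms of a groupoid with object set `X`. -/
@[ext] structure Mor (X : Type v) [Groupoid.{w} X] : Type (max v w) where
  src : X
  tgt : X
  hom : src ⟶ tgt

/-- A (set-theoretic) section of the source map: a choice of a morphism starting at each object.
Only its values on a given open set will matter; elsewhere one may choose identities. -/
abbrev SrcSection (X : Type v) [Groupoid.{w} X] : Type (max v w) := ∀ y : X, Σ y' : X, (y ⟶ y')

/-- A section of the source map, as a map from objects to morphisms. -/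
def SrcSection.toMor {X : Type v} [Groupoid.{w} X] (a : SrcSection X) (y : X) : Mor X :=
  ⟨y, (a y).1, (a y).2⟩

/-- An ep-groupoid: a groupoid with M-polyfold structures on objects and morphisms such that all
structure maps are sc-smooth, source and target are surjective local sc-diffeomorphisms, and the
properness axiom holds.

As the source map is a local sc-diffeomorphism, the fibered product of the composable pairs `(h, g)`
with `s(h) = t(g)` has the M-polyfold structure for which the projection `(h, g) ↦ g` is a local
sc-diffeomorphism, with local inverses `g ↦ (a(t(g)), g)` for local sc-smooth sections `a` of `s`.
So the multiplication is sc-smooth if and only if every map `g ↦ a(t(g)) ∘ g` is. -/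
structure EpGroupoid (X : Type v) [TopologicalSpace X] [Groupoid.{w} X]
    [TopologicalSpace (Mor X)] : Type (max v w (u + 1)) where
  ob : MPolyfold.{u} X
  mor : MPolyfold.{u} (Mor X)
  src_diffeo : mor.IsLocalScDiffeo ob Mor.src
  tgt_diffeo : mor.IsLocalScDiffeo ob Mor.tgt
  src_surj : Function.Surjective (Mor.src : Mor X → X)
  tgt_surj : Function.Surjective (Mor.tgt : Mor X → X)
  unit_smooth : ob.ScSmoothOn mor Set.univ (fun x => ⟨x, x, 𝟙 x⟩)
  inv_smooth : mor.ScSmoothOn mor Set.univ (fun g => ⟨g.tgt, g.src, Groupoid.inv g.hom⟩)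
  mul_smooth : ∀ (V : Set X) (a : SrcSection X), IsOpen V → ob.ScSmoothOn mor V a.toMor →
    mor.ScSmoothOn mor (Mor.tgt ⁻¹' V) (fun g => ⟨g.src, (a g.tgt).1, g.hom ≫ (a g.tgt).2⟩)
  proper : ∀ x : X, ∃ V : Set X, IsOpen V ∧ x ∈ V ∧
    IsProperMap (fun g : {g : Mor X // g.src ∈ closure V} => g.1.tgt)

namespace EpGroupoid

variable {X : Type v} [TopologicalSpace X] [Groupoid.{w} X] [TopologicalSpace (Mor X)]

/-- The isotropy group of `x` acts on the open neighborhood `U` of `x` by its natural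
representation: there is `Γ : G_x × U → 𝐗`, sc-smooth, with `Γ(g,x) = g`, `s(Γ(g,y)) = y` and
`t(Γ(g,y)) = φ_g(y)`, where `g ↦ φ_g` is a homomorphism into the group of sc-diffeomorphisms of `U`,
such that every morphism `h : y → y'` between points of `U` is `Γ(g,y)` for a unique `g ∈ G_x`.
(The composition `g ∘ h` is written `h ≫ g`.) -/
def HasNaturalRep (G : EpGroupoid.{u} X) (x : X) (U : Set X) : Prop :=
  IsOpen U ∧ x ∈ U ∧ ∃ Γ : (x ⟶ x) → SrcSection X,
    (∀ g, G.ob.ScSmoothOn G.mor U (Γ g).toMor) ∧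
    (∀ g, Γ g x = ⟨x, g⟩) ∧
    (∀ g, ∀ y ∈ U, (Γ g y).1 ∈ U) ∧
    (∀ g, G.ob.ScSmoothOn G.ob U (fun y => (Γ g y).1)) ∧
    (∀ y ∈ U, (Γ (𝟙 x) y).1 = y) ∧
    (∀ g h, ∀ y ∈ U, (Γ (h ≫ g) y).1 = (Γ g (Γ h y).1).1) ∧
    (∀ y ∈ U, ∀ y' ∈ U, ∀ h : y ⟶ y', ∃! g : x ⟶ x, Γ g y = ⟨y', h⟩)

end EpGroupoid

/-- A set of objects is saturated: it contains with an object all isomorphic ones. -/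
def IsSaturated {X : Type v} [Groupoid.{w} X] (U : Set X) : Prop :=
  ∀ ⦃x y : X⦄, (x ⟶ y) → x ∈ U → y ∈ U

/-! ## Strong bundles -/

/-- A strong bundle splicing `(ρ, F, (O, S))` over an open subset `O` of the core of `S`: bounded
linear projections `ρ_p` of `F`, `p ∈ O`, such that `(p,u) ↦ ρ_p(u)` is sc-smooth as a map
`O ⊕ F → F`, and restricts to a family of bounded projections of `F¹` that is sc-smooth as a map
`O ⊕ F¹ → F¹`. -/
structure StrongSplicing (S : Splicing.{u}) (O : Set (S.amb.lvl 0)) : Type (u + 1) where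
  F : ScBanach.{u}
  ρ : S.amb.lvl 0 → F.lvl 0 →L[ℝ] F.lvl 0
  idem : ∀ p ∈ O, ∀ e, ρ p (ρ p e) = ρ p e
  smooth : IsScSmooth (E := S.amb.prod F) (F := F) {q | q.1.1 ∈ S.V ∧ S.ret q.1 ∈ O}
    (fun q => ρ (S.ret q.1) q.2)
  strong : ∃ ρ₁ : S.amb.lvl 0 → F.lvl 1 →L[ℝ] F.lvl 1,
    (∀ p ∈ O, ∀ e, F.incl 0 (ρ₁ p e) = ρ p (F.incl 0 e)) ∧
    IsScSmooth (E := S.amb.prod F.shift) (F := F.shift) {q | q.1.1 ∈ S.V ∧ S.ret q.1 ∈ O}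
      (fun q => ρ₁ (S.ret q.1) q.2)

/-- The total space of a family of vector spaces. -/
abbrev Tot {X : Type v} (Fib : X → Type z) : Type (max v z) := Bundle.TotalSpace Unit Fib

/-- A strong bundle chart of `p : E → X`: a homeomorphism `Φ : p⁻¹(U) → K`, linear on the fibers,
onto the core `K = {(p,u) ∈ O ⊕ F | ρ_p(u) = u}` of a strong bundle splicing, covering a chart
`φ : U → O` of `X`. -/
structure BundleChart {X : Type v} [TopologicalSpace X] (Fib : X → Type z)
    [∀ x, AddCommGroup (Fib x)] [∀ x, Module ℝ (Fib x)] [TopologicalSpace (Tot Fib)] :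
    Type (max v z (u + 1)) where
  base : MPChart.{u} X
  R : StrongSplicing.{u} base.S base.φ.target
  Φ : PartialEquiv (Tot Fib) (base.S.amb.lvl 0 × R.F.lvl 0)
  source_eq : Φ.source = {e | e.proj ∈ base.φ.source}
  target_eq : Φ.target = {q | q.1 ∈ base.φ.target ∧ R.ρ q.1 q.2 = q.2}
  cont : ContinuousOn Φ Φ.source
  cont_symm : ContinuousOn Φ.symm Φ.target
  covers : ∀ e ∈ Φ.source, (Φ e).1 = base.φ e.proj
  linear : ∀ x ∈ base.φ.source, IsLinearMap ℝ (fun a : Fib x => (Φ ⟨x, a⟩).2)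

namespace BundleChart

variable {X : Type v} [TopologicalSpace X] {Fib : X → Type z}
  [∀ x, AddCommGroup (Fib x)] [∀ x, Module ℝ (Fib x)] [TopologicalSpace (Tot Fib)]

/-- The space `W ⊕ E` in which the base model lives. -/
@[reducible] noncomputable def amb (b : BundleChart.{u} Fib) : ScBanach.{u} := b.base.S.amb

/-- The fiber model `F`. -/
@[reducible] noncomputable def F (b : BundleChart.{u} Fib) : ScBanach.{u} := b.R.F

/-- The retraction of `V ⊕ E ⊕ F` (over the preimage of `O`) onto the core of the strong bundle
splicing. -/
noncomputable def ret (b : BundleChart.{u} Fib) (q : b.amb.lvl 0 × b.F.lvl 0) : b.amb.lvl 0 × b.F.lvl 0 :=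
  (b.base.S.ret q.1, b.R.ρ (b.base.S.ret q.1) q.2)

/-- The representation of `f : E → E` in the charts `b` and `b'`. -/
noncomputable def rep (b b' : BundleChart.{u} Fib) (f : Tot Fib → Tot Fib) (q : b.amb.lvl 0 × b.F.lvl 0) :
    b'.amb.lvl 0 × b'.F.lvl 0 :=
  b'.Φ (f (b.Φ.symm (b.ret q)))

/-- In the charts `b` and `b'`, the map `f`, restricted to the part of `E` over `A`, is smooth
between strong bundles: it is sc-smooth for the filtration `(m, m)`, and restricts to an
sc-smooth map for the filtration `(m, m+1)` of bi-levels. -/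
def StrongSmooth (b b' : BundleChart.{u} Fib) (A : Set X) (f : Tot Fib → Tot Fib) : Prop :=
  IsScSmooth (E := b.amb.prod b.F) (F := b'.amb.prod b'.F) {q | q.1 ∈ b.base.pull A}
    (b.rep b' f) ∧
  ∃ f₁ : b.amb.lvl 0 × b.F.lvl 1 → b'.amb.lvl 0 × b'.F.lvl 1,
    (∀ q, q.1 ∈ b.base.pull A →
      ((f₁ q).1, b'.F.incl 0 (f₁ q).2) = b.rep b' f (q.1, b.F.incl 0 q.2)) ∧
    IsScSmooth (E := b.amb.prod b.F.shift) (F := b'.amb.prod b'.F.shift)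
      {q | q.1 ∈ b.base.pull A} f₁

end BundleChart

/-- A strong bundle over the ep-groupoid `G`: a strong M-polyfold bundle over the object space,
given by an atlas of strong bundle charts, with linear maps `μ(g,·) : E_x → E_y` for the morphisms
`g : x → y`, functorial in `g`, that together form a strong bundle map
`μ : 𝐄 = 𝐗 ×_{s,p} E → E` covering the target map.

Over the image of a local sc-smooth section `a` of the source map, the pull-back bundle `𝐄` is
identified with `E`, the inverse of the projection `(g, e) ↦ e` being `e ↦ (a(p(e)), e)`; so `μ` is
a strong bundle map if and only if all the maps `e ↦ μ(a(p(e)), e)` are smooth between strong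
bundles. Functoriality then implies that `μ` is surjective and a local diffeomorphism, its local
inverses being given by the inverse morphisms. -/
structure StrongBundle {X : Type v} [TopologicalSpace X] [Groupoid.{w} X]
    [TopologicalSpace (Mor X)] (G : EpGroupoid.{u} X) (Fib : X → Type z)
    [∀ x, AddCommGroup (Fib x)] [∀ x, Module ℝ (Fib x)] [TopologicalSpace (Tot Fib)] :
    Type (max v w z (u + 1)) where
  t2 : T2Space (Tot Fib)
  second_countable : SecondCountableTopology (Tot Fib)
  paracompact : ParacompactSpace (Tot Fib)
  proj_cont : Continuous (fun e : Tot Fib => e.proj)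
  atlas : Set (BundleChart.{u} Fib)
  cover : ∀ x, ∃ b ∈ atlas, x ∈ b.base.φ.source
  base_compat : ∀ b ∈ atlas, ∀ c ∈ G.ob.atlas, b.base.Transition c ∧ c.Transition b.base
  compat : ∀ b ∈ atlas, ∀ b' ∈ atlas, b.StrongSmooth b' b'.base.φ.source id
  μ : ∀ {x y : X}, (x ⟶ y) → Fib x →ₗ[ℝ] Fib y
  μ_id : ∀ (x : X) (e : Fib x), μ (𝟙 x) e = e
  μ_comp : ∀ {x y y' : X} (g : x ⟶ y) (h : y ⟶ y') (e : Fib x), μ (g ≫ h) e = μ h (μ g e)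
  μ_smooth : ∀ (V : Set X) (a : SrcSection X), IsOpen V → G.ob.ScSmoothOn G.mor V a.toMor →
    ∀ b ∈ atlas, ∀ b' ∈ atlas, b.StrongSmooth b' (V ∩ {y | (a y).1 ∈ b'.base.φ.source})
      (fun e => ⟨(a e.proj).1, μ (a e.proj).2 e.snd⟩)

namespace StrongBundle

variable {X : Type v} [TopologicalSpace X] [Groupoid.{w} X] [TopologicalSpace (Mor X)]
  {G : EpGroupoid.{u} X} {Fib : X → Type z} [∀ x, AddCommGroup (Fib x)] [∀ x, Module ℝ (Fib x)]
  [TopologicalSpace (Tot Fib)]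

/-- The strong bundle charts are modelled on separable sc-Hilbert spaces. -/
def IsSeparableHilbert (P : StrongBundle G Fib) : Prop :=
  ∀ b ∈ P.atlas, b.base.S.W.IsSeparableHilbert ∧ b.base.S.E.IsSeparableHilbert ∧
    b.F.IsSeparableHilbert

/-- `e` is a smooth point of `E`: it lies on every level `(m, m)`. -/
def IsSmoothPoint (P : StrongBundle G Fib) (e : Tot Fib) : Prop :=
  ∃ b ∈ P.atlas, e ∈ b.Φ.source ∧ ∀ m, b.Φ e ∈ Set.range ((b.amb.prod b.F).emb m)

/-- The subset `E_{0,1}` of `E`. -/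
def E01 (P : StrongBundle G Fib) : Set (Tot Fib) :=
  {e | ∃ b ∈ P.atlas, e ∈ b.Φ.source ∧ (b.Φ e).2 ∈ Set.range (b.F.incl 0)}

/-- Mixed convergence in `E_{0,1}`: the base points converge in `X`, and in a strong bundle chart
around the limit the fiber components converge weakly in `F₁`. -/
def MConverges (P : StrongBundle G Fib) (y : ℕ → Tot Fib) (y₀ : Tot Fib) : Prop :=
  Tendsto (fun k => (y k).proj) atTop (𝓝 y₀.proj) ∧
  ∃ b ∈ P.atlas, y₀ ∈ b.Φ.source ∧ ∃ (a : ℕ → b.F.lvl 1) (a₀ : b.F.lvl 1),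
    b.F.incl 0 a₀ = (b.Φ y₀).2 ∧
    (∀ᶠ k in atTop, y k ∈ b.Φ.source ∧ b.F.incl 0 (a k) = (b.Φ (y k)).2) ∧
    ∀ l : b.F.lvl 1 →L[ℝ] ℝ, Tendsto (fun k => l (a k)) atTop (𝓝 (l a₀))

/-- An auxiliary norm `N : E_{0,1} → [0,∞)`; values of `N` outside `E_{0,1}` are irrelevant.
Continuity on `E_{0,1}` refers to the topology of bi-level `(0,1)`, hence to `O ⊕ F₁` in charts. -/
structure IsAuxiliaryNorm (P : StrongBundle G Fib) (N : Tot Fib → ℝ≥0) : Prop where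
  continuous : ∀ b ∈ P.atlas,
    ContinuousOn (fun q : b.amb.lvl 0 × b.F.lvl 1 => N (b.Φ.symm (q.1, b.F.incl 0 q.2)))
      {q | (q.1, b.F.incl 0 q.2) ∈ b.Φ.target}
  add_le : ∀ (x : X) (e e' : Fib x), ⟨x, e⟩ ∈ P.E01 → ⟨x, e'⟩ ∈ P.E01 →
    N ⟨x, e + e'⟩ ≤ N ⟨x, e⟩ + N ⟨x, e'⟩
  smul : ∀ (x : X) (r : ℝ) (e : Fib x), ⟨x, e⟩ ∈ P.E01 → N ⟨x, r • e⟩ = ‖r‖₊ * N ⟨x, e⟩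
  eq_zero : ∀ (x : X) (e : Fib x), ⟨x, e⟩ ∈ P.E01 → N ⟨x, e⟩ = 0 → e = 0
  complete : ∀ (x : X) (e : ℕ → Fib x), (∀ k, ⟨x, e k⟩ ∈ P.E01) →
    (∀ δ > 0, ∃ n, ∀ k ≥ n, ∀ l ≥ n, N ⟨x, e k - e l⟩ < δ) →
    ∃ e₀ : Fib x, ⟨x, e₀⟩ ∈ P.E01 ∧ Tendsto (fun k => N ⟨x, e k - e₀⟩) atTop (𝓝 0)
  le_liminf : ∀ (y : ℕ → Tot Fib) (y₀ : Tot Fib), (∀ k, y k ∈ P.E01) → P.MConverges y y₀ →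
    (N y₀ : ℝ≥0∞) ≤ liminf (fun k => (N (y k) : ℝ≥0∞)) atTop
  compact : ∀ (y : ℕ → Tot Fib) (x : X), (∀ k, y k ∈ P.E01) → (∃ B, ∀ k, N (y k) ≤ B) →
    Tendsto (fun k => (y k).proj) atTop (𝓝 x) →
    ∃ (y₀ : Tot Fib) (κ : ℕ → ℕ), StrictMono κ ∧ P.MConverges (y ∘ κ) y₀
  invariant : ∀ {x y : X} (g : x ⟶ y) (e : Fib x), ⟨x, e⟩ ∈ P.E01 →
    N ⟨y, P.μ g e⟩ = N ⟨x, e⟩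

/-- `s` is an sc⁺-section of (the bundle of objects) `E` over the open set `U`: it is sc-smooth as a
map into `E^{0,1}`, that is, in charts its principal part is sc-smooth as a map into `F¹`. -/
def IsScPlusSectionOn (P : StrongBundle G Fib) (U : Set X) (s : ∀ x, Fib x) : Prop :=
  ∀ b ∈ P.atlas, ∃ f : b.amb.lvl 0 → b.F.lvl 1,
    (∀ q ∈ b.base.pull U, b.F.incl 0 (f q) =
      (b.Φ ⟨b.base.φ.symm (b.base.S.ret q), s (b.base.φ.symm (b.base.S.ret q))⟩).2) ∧
    IsScSmooth (E := b.amb) (F := b.F.shift) (b.base.pull U) f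

open Classical in
/-- `Λ : E → ℚ⁺ = ℚ ∩ [0,∞)` is an sc⁺-multisection: it is a functor (`ℚ⁺` having only identity
morphisms) with a local section structure near every object. -/
structure IsScPlusMultisection (P : StrongBundle G Fib) (Λ : Tot Fib → ℚ≥0) : Prop where
  functor : ∀ {x y : X} (g : x ⟶ y) (e : Fib x), Λ ⟨y, P.μ g e⟩ = Λ ⟨x, e⟩
  loc : ∀ x : X, ∃ U : Set X, G.HasNaturalRep x U ∧
    ∃ (k : ℕ) (s : Fin k → ∀ y, Fib y) (σ : Fin k → ℚ≥0),
      (∀ j, P.IsScPlusSectionOn U (s j)) ∧ (∀ j, 0 < σ j) ∧ ∑ j, σ j = 1 ∧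
      ∀ y ∈ U, ∀ e : Fib y, Λ ⟨y, e⟩ = ∑ j with s j y = e, σ j

end StrongBundle

/-- `Λ` is trivial on `V`: it is identically `1` on the zero section over `V`. -/
def TrivialOn {X : Type v} {Fib : X → Type z} [∀ x, AddCommGroup (Fib x)]
    (Λ : Tot Fib → ℚ≥0) (V : Set X) : Prop :=
  ∀ x ∈ V, Λ ⟨x, 0⟩ = 1

/-- The support of `Λ`: the smallest closed set outside of which `Λ` is trivial. -/
def multisectionSupport {X : Type v} [TopologicalSpace X] {Fib : X → Type z}
    [∀ x, AddCommGroup (Fib x)] (Λ : Tot Fib → ℚ≥0) : Set X :=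
  ⋂₀ {A | IsClosed A ∧ TrivialOn Λ Aᶜ}

end Polyfold

/-!
Near the base point `x` of `e` there is an sc⁺-section `s` with `s x = e`: in a strong bundle chart,
project the constant section given by the (smooth) fiber component of `e`, and multiply by a cutoff
function, which exists since the square of a Hilbert norm on level zero is smooth
(`BundleChart.modelSection`, `BundleChart.exists_cutoff`). The multisection is the symmetrization of
`s`. Choose a small open neighborhood `U₀` of `x` on which the isotropy group acts by its natural
representation (`EpGroupoid.exists_hasNaturalRep`), with `s` supported in a closed set `A ⊆ U₀`. For
a vector `h` over `y`, let `Λ h` be the proportion of those arrows `m` from `y` into `U₀` that take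
`h` to a value of `s`, and let `Λ` be trivial over the points without such arrows
(`StrongBundle.average`).

Precomposition with arrows makes `Λ` a functor. From a point isomorphic to a point of `U₀` there are
exactly as many arrows into `U₀` as there are isotropies of `x`. So, if `y` is such a point, the
local sections of the source map through the finitely many arrows from `y` into `U₀` exhaust all
arrows into `U₀` near `y`, and the pull-backs of `s` along them are the local sections of `Λ`, with
equal weights. By properness the saturation of `A` is closed, and `Λ` is trivial outside of it
(`StrongBundle.isScPlusMultisection_average`); as `U` is saturated, the support of `Λ` lies in `U`.
The identity arrow of `x` shows `Λ e > 0`. Finally, `N` is invariant under arrows, multiplication by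
the cutoff function decreases it, and it is continuous along the local section, so that it stays
below `ε` if it is so at `e` and `U₀` is small.

The sc-calculus behind this consists of the chain rule (`IsSc.comp`), which rests on the compactness
of the inclusions between the levels, and of the locality of sc-smoothness (`IsSc.of_locally`),
which rests on the uniqueness of the derivatives. Natural representations are built from local
sections of the source map through the isotropies: the group law holds near `x` because such
sections are determined by their value at `x`, and by properness the sections contain all arrows
between points close to `x` (`EpGroupoid.exists_forall_mor_mem`).
-/

namespace Polyfold

section

open scoped ContDiff

/-! ### Levels of sc-Banach spaces -/

namespace ScBanach

theorem emb_injective (E : ScBanach.{u}) : ∀ m, Function.Injective (E.emb m)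
  | 0 => Function.injective_id
  | m + 1 => (E.emb_injective m).comp (E.incl_injective m)

theorem prod_emb (E F : ScBanach.{u}) : ∀ (m : ℕ) (p : E.lvl m × F.lvl m),
    (E.prod F).emb m p = (E.emb m p.1, F.emb m p.2)
  | 0, _ => rfl
  | m + 1, p => prod_emb E F m (E.incl m p.1, F.incl m p.2)

theorem incl_shift_emb (E : ScBanach.{u}) : ∀ (m : ℕ) (x : E.lvl (m + 1)),
    E.incl 0 (E.shift.emb m x) = E.emb (m + 1) x
  | 0, _ => rfl
  | m + 1, x => incl_shift_emb E m (E.incl (m + 1) x)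

theorem denseRange_incl (E : ScBanach.{u}) (m : ℕ) : DenseRange (E.incl m) :=
  (E.dense m).mono (by rintro x ⟨s, hs, rfl⟩; exact ⟨_, hs m⟩)

end ScBanach

/-- The domains on which the sc-calculus is developed: relatively open subsets of a convex set `K`
that has interior points on every level. Relatively open subsets of partial quadrants, and their
tangents, are of this kind. Convexity is what the mean value inequality in the chain rule needs, the
interior points make derivatives unique. -/
def IsScDomain (E : ScBanach.{u}) (U : Set (E.lvl 0)) : Prop :=
  ∃ O K : Set (E.lvl 0), IsOpen O ∧ Convex ℝ K ∧
    (∀ m, (interior {x : E.lvl m | E.emb m x ∈ K}).Nonempty) ∧ U = O ∩ K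

namespace IsScDomain

variable {E F : ScBanach.{u}} {U : Set (E.lvl 0)}

theorem univ : IsScDomain E Set.univ :=
  ⟨Set.univ, Set.univ, isOpen_univ, convex_univ, fun m => by simp, by simp⟩

theorem inter (hU : IsScDomain E U) {O : Set (E.lvl 0)} (hO : IsOpen O) :
    IsScDomain E (U ∩ O) := by
  obtain ⟨O', K, h1, h2, h3, rfl⟩ := hU
  exact ⟨O' ∩ O, K, h1.inter hO, h2, h3, by ext; simp; tauto⟩

theorem prod_univ (hU : IsScDomain E U) :
    IsScDomain (E.prod F) {p : E.lvl 0 × F.lvl 0 | p.1 ∈ U} := by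
  obtain ⟨O, K, h1, h2, h3, rfl⟩ := hU
  refine ⟨{p : E.lvl 0 × F.lvl 0 | p.1 ∈ O}, {p : E.lvl 0 × F.lvl 0 | p.1 ∈ K},
    h1.preimage continuous_fst, h2.linear_preimage (LinearMap.fst ℝ (E.lvl 0) (F.lvl 0)),
    fun m => ?_, rfl⟩
  obtain ⟨x, hx⟩ := h3 m
  refine ⟨(x, 0), mem_interior.2 ⟨{p : E.lvl m × F.lvl m | p.1 ∈ interior {x | E.emb m x ∈ K}},
    fun p hp => ?_, isOpen_interior.preimage continuous_fst, hx⟩⟩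
  have := interior_subset hp
  have h : ((E.prod F).emb m p).1 = E.emb m p.1 := congrArg Prod.fst (ScBanach.prod_emb E F m p)
  exact (congrArg (· ∈ K) h).mpr this

theorem shift (hU : IsScDomain E U) :
    IsScDomain E.shift {x : E.lvl 1 | E.incl 0 x ∈ U} := by
  obtain ⟨O, K, h1, h2, h3, rfl⟩ := hU
  refine ⟨{x : E.lvl 1 | E.incl 0 x ∈ O}, {x : E.lvl 1 | E.incl 0 x ∈ K},
    h1.preimage (E.incl 0).continuous, h2.linear_preimage (E.incl 0).toLinearMap,
    fun m => ?_, rfl⟩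
  have h : {x : E.lvl (m + 1) | E.incl 0 (E.shift.emb m x) ∈ K} =
      {x : E.lvl (m + 1) | E.emb (m + 1) x ∈ K} :=
    Set.ext fun x => iff_of_eq (congrArg (· ∈ K) (E.incl_shift_emb m x))
  exact h ▸ h3 (m + 1)

theorem tangent (hU : IsScDomain E U) :
    IsScDomain E.tangent {p : E.lvl 1 × E.lvl 0 | E.incl 0 p.1 ∈ U} :=
  hU.shift.prod_univ (F := E)

theorem uniqueDiffOn (hU : IsScDomain E U) :
    UniqueDiffOn ℝ {x : E.lvl 1 | E.incl 0 x ∈ U} := by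
  obtain ⟨O, K, h1, h2, h3, rfl⟩ := hU
  have h := (uniqueDiffOn_convex (h2.linear_preimage (E.incl 0).toLinearMap) (h3 1)).inter
    (h1.preimage (E.incl 0).continuous)
  rw [Set.inter_comm] at h
  exact h

end IsScDomain

/-! ### The chain rule -/

section ChainRule

variable {E₁ E₀ F₁ F₀ H : Type*} [NormedAddCommGroup E₁] [NormedSpace ℝ E₁]
  [NormedAddCommGroup E₀] [NormedSpace ℝ E₀] [NormedAddCommGroup F₁]
  [NormedAddCommGroup F₀] [NormedSpace ℝ F₀] [NormedAddCommGroup H] [NormedSpace ℝ H]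

/-- Pointwise continuity of a family of operators, jointly with the argument, gives a uniform bound
on the operator norms. -/
theorem eventually_opNorm_le {V : Set F₁} {a : F₁} (D : F₁ → F₀ →L[ℝ] H)
    (hD : ContinuousWithinAt (fun p : F₁ × F₀ => D p.1 p.2) {p | p.1 ∈ V} (a, 0)) :
    ∃ C > 0, ∀ᶠ z in 𝓝[V] a, ‖D z‖ ≤ C := by
  have h1 : ∀ᶠ p in 𝓝[{p : F₁ × F₀ | p.1 ∈ V}] (a, 0), ‖D p.1 p.2‖ < 1 := by
    have := hD.norm.tendsto
    simp only [map_zero, norm_zero] at this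
    exact this.eventually_lt_const one_pos
  have h2 : {p : F₁ × F₀ | p.1 ∈ V} = V ×ˢ Set.univ := by ext; simp
  rw [h2, nhdsWithin_prod_eq, nhdsWithin_univ] at h1
  obtain ⟨p, hp, q, hq, hpq⟩ := eventually_prod_iff.1 h1
  obtain ⟨δ, hδ, hball⟩ := Metric.eventually_nhds_iff_ball.1 hq
  refine ⟨2 / δ, by positivity, hp.mono fun z hz => ?_⟩
  refine (D z).opNorm_le_of_shell (c := (2 : ℝ)) hδ (by positivity) (by norm_num) fun w hw hw' => ?_
  have h3 : δ ≤ 2 * ‖w‖ := by rw [Real.norm_ofNat] at hw; linarith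
  calc ‖D z w‖ ≤ 1 := (hpq hz (hball w (by simpa using hw'))).le
    _ ≤ 2 / δ * ‖w‖ := by rw [div_mul_eq_mul_div, le_div_iff₀ hδ]; linarith

/-- If `f` is continuous into `F₁` and differentiable into `F₀`, and `g` is differentiable on `F₁`
with derivatives extending to a pointwise continuous family of operators on `F₀`, then `g ∘ f` is
differentiable on `E₁`, because the inclusion of `E₁` is compact. -/
theorem hasFDerivWithinAt_comp_of_compact [NormedSpace ℝ F₁] (i : E₁ →L[ℝ] E₀)
    (hi : IsCompactOperator i) (j : F₁ →L[ℝ] F₀) {S : Set E₁} {V O K : Set F₁}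
    (hO : IsOpen O) (hK : Convex ℝ K)
    (hV : V = O ∩ K) {f : E₁ → F₁} {A : E₀ →L[ℝ] F₀} {g : F₁ → H} {D : F₁ → F₀ →L[ℝ] H} {x : E₁}
    (hx : x ∈ S) (hmaps : Set.MapsTo f S V) (hfc : ContinuousWithinAt f S x)
    (hf : HasFDerivWithinAt (fun y => j (f y)) (A.comp i) S x)
    (hg : ∀ z ∈ V, HasFDerivWithinAt g ((D z).comp j) V z)
    (hD : ContinuousOn (fun p : F₁ × F₀ => D p.1 p.2) {p | p.1 ∈ V}) :
    HasFDerivWithinAt (fun y => g (f y)) (((D (f x)).comp A).comp i) S x := by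
  have haV := hmaps hx
  set a := f x with ha
  obtain ⟨C, hC, hbound⟩ := eventually_opNorm_le D (hD (a, 0) haV)
  -- By compactness of `i`, on the image of the unit ball of `E₁` the operators `D z` converge
  -- uniformly to `D a`.
  obtain ⟨L, hL, hiL⟩ := hi.image_closedBall_subset_compact 1
  have hunif : ∀ c > 0, ∀ᶠ z in 𝓝 a, ∀ k ∈ L, z ∈ V → ‖D z (A k) - D a (A k)‖ < c := by
    intro c hc
    refine hL.eventually_forall_of_forall_eventually fun k _ => ?_
    have h1 : ContinuousWithinAt (fun p : F₁ × E₀ => D p.1 (A p.2) - D a (A p.2))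
        {p | p.1 ∈ V} (a, k) := by
      have h2 : ContinuousWithinAt (fun p : F₁ × E₀ => D p.1 (A p.2)) {p | p.1 ∈ V} (a, k) :=
        ContinuousWithinAt.comp (f := fun p : F₁ × E₀ => (p.1, A p.2)) (x := (a, k))
          (hD (a, A k) haV) (Continuous.continuousWithinAt (by fun_prop)) (fun p hp => hp)
      exact h2.sub (by fun_prop)
    have h3 := h1.norm.tendsto
    simp only [sub_self, norm_zero] at h3
    exact eventually_nhdsWithin_iff.1 (h3.eventually_lt_const hc)
  rw [hasFDerivWithinAt_iff_isLittleO, Asymptotics.isLittleO_iff]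
  intro c hc
  have hf' := (Asymptotics.isLittleO_iff.1 (hasFDerivWithinAt_iff_isLittleO.1 hf))
    (show 0 < c / (6 * C) by positivity)
  obtain ⟨r, hr, hW⟩ := Metric.eventually_nhds_iff_ball.1
    (((eventually_nhdsWithin_iff.1 hbound).and (hunif (c / 3) (by positivity))).and
      (hO.mem_nhds (hV ▸ haV : a ∈ O ∩ K).1))
  have hfW : ∀ᶠ y in 𝓝[S] x, f y ∈ Metric.ball a r ∩ V :=
    (hfc.eventually_mem (Metric.ball_mem_nhds a hr)).and
      (eventually_mem_nhdsWithin.mono fun y hy => hmaps hy)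
  filter_upwards [hf', hfW] with y hy hfy
  set h := y - x with hh
  set b := f y with hb
  have hconv : Convex ℝ (Metric.ball a r ∩ K) := (convex_ball a r).inter hK
  have hab : ∀ t ∈ Set.Icc (0 : ℝ) 1, a + t • (b - a) ∈ Metric.ball a r ∩ V := by
    intro t ht
    have h1 : a + t • (b - a) ∈ Metric.ball a r ∩ K :=
      hconv.add_smul_sub_mem ⟨Metric.mem_ball_self hr, (hV ▸ haV : a ∈ O ∩ K).2⟩
        ⟨hfy.1, (hV ▸ hfy.2 : b ∈ O ∩ K).2⟩ ht
    exact ⟨h1.1, hV ▸ ⟨(hW _ h1.1).2, h1.2⟩⟩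
  set ρ := j b - j a - A (i h) with hρ
  have hρn : ‖ρ‖ ≤ c / (6 * C) * ‖h‖ := by simpa [hρ] using hy
  have hjb : j (b - a) = A (i h) + ρ := by simp [hρ]
  have hAi : ∀ z ∈ Metric.ball a r ∩ V, ‖D z (A (i h)) - D a (A (i h))‖ ≤ c / 3 * ‖h‖ := by
    intro z hz
    rcases eq_or_ne h 0 with h0 | h0
    · simp [h0]
    have h1 := ((hW z hz.1).1.2 (i (‖h‖⁻¹ • h)) (hiL ⟨_, by simp [norm_smul, h0], rfl⟩) hz.2).le
    simp only [map_smul, ← smul_sub, norm_smul, norm_inv, norm_norm] at h1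
    rwa [inv_mul_le_iff₀ (norm_pos_iff.2 h0), mul_comm] at h1
  have hCρ : ∀ z ∈ Metric.ball a r ∩ V, ‖D z ρ‖ ≤ c / 6 * ‖h‖ := by
    intro z hz
    calc ‖D z ρ‖ ≤ ‖D z‖ * ‖ρ‖ := (D z).le_opNorm ρ
      _ ≤ C * (c / (6 * C) * ‖h‖) := by gcongr; exact (hW z hz.1).1.1 hz.2
      _ = c / 6 * ‖h‖ := by field_simp
  have haW : a ∈ Metric.ball a r ∩ V := ⟨Metric.mem_ball_self hr, haV⟩
  -- The mean value inequality is applied to `g` minus its linearization at `a`, along the segment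
  -- from `a` to `b`; only the derivatives in the direction `j (b - a) = A (i h) + ρ` matter.
  have hder : ∀ t ∈ Set.Icc (0 : ℝ) 1, HasDerivWithinAt
      (fun t : ℝ => g (a + t • (b - a)) - t • D a (j (b - a)))
      (D (a + t • (b - a)) (j (b - a)) - D a (j (b - a))) (Set.Icc 0 1) t := by
    intro t ht
    have h1 : HasDerivWithinAt (fun t : ℝ => a + t • (b - a)) (b - a) (Set.Icc 0 1) t := by
      simpa using (((hasDerivAt_id t).smul_const (b - a)).const_add a).hasDerivWithinAt
    have h2 := (hg _ (hab t ht).2).comp_hasDerivWithinAt t h1 (fun t ht => (hab t ht).2)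
    have h3 : HasDerivWithinAt (fun t : ℝ => t • D a (j (b - a))) (D a (j (b - a)))
      (Set.Icc 0 1) t := by
      simpa using ((hasDerivAt_id t).smul_const (D a (j (b - a)))).hasDerivWithinAt
    exact h2.sub h3
  have hmv := norm_image_sub_le_of_norm_deriv_le_segment_01'
      (C := c / 3 * ‖h‖ + c / 6 * ‖h‖ + c / 6 * ‖h‖) hder (by
    intro t ht
    have hz := hab t ⟨ht.1, ht.2.le⟩
    have e : D (a + t • (b - a)) (j (b - a)) - D a (j (b - a)) =
      (D (a + t • (b - a)) (A (i h)) - D a (A (i h))) + D (a + t • (b - a)) ρ - D a ρ := by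
      rw [hjb]; simp only [map_add]; abel
    rw [e]
    exact (norm_sub_le _ _).trans (add_le_add ((norm_add_le _ _).trans
      (add_le_add (hAi _ hz) (hCρ _ hz))) (hCρ _ haW)))
  have e : g b - g a - D a (A (i h)) = (g (a + (1 : ℝ) • (b - a)) - (1 : ℝ) • D a (j (b - a)) -
      (g (a + (0 : ℝ) • (b - a)) - (0 : ℝ) • D a (j (b - a)))) + D a ρ := by
    rw [hjb]; simp only [one_smul, zero_smul, map_add, add_sub_cancel, add_zero, sub_zero]; abel
  show ‖g b - g a - D a (A (i h))‖ ≤ c * ‖h‖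
  rw [e]
  refine (norm_add_le _ _).trans ((add_le_add hmv (hCρ a haW)).trans ?_)
  nlinarith [norm_nonneg h]

end ChainRule

/-! ### Maps of class sc^n -/

section ScCalculus

variable {E F H : ScBanach.{u}} {U : Set (E.lvl 0)} {V : Set (F.lvl 0)}
  {f f' : E.lvl 0 → F.lvl 0} {g : F.lvl 0 → H.lvl 0} {n : ℕ}

theorem IsSc0.continuousOn (h : IsSc0 U f) : ContinuousOn f U := by
  obtain ⟨f0, h1, h2⟩ := h 0
  exact h2.congr fun x hx => (h1 x hx).symm

theorem IsSc0.congr (h : IsSc0 U f) (e : Set.EqOn f' f U) : IsSc0 U f' := fun m => by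
  obtain ⟨fm, h1, h2⟩ := h m
  exact ⟨fm, fun x hx => (h1 x hx).trans (e hx).symm, h2⟩

theorem IsSc0.mono (h : IsSc0 U f) {U' : Set (E.lvl 0)} (hU : U' ⊆ U) : IsSc0 U' f := fun m => by
  obtain ⟨fm, h1, h2⟩ := h m
  exact ⟨fm, fun x hx => h1 x (hU hx), h2.mono fun x hx => hU hx⟩

theorem IsSc0.comp (hg : IsSc0 V g) (hf : IsSc0 U f) (h : Set.MapsTo f U V) :
    IsSc0 U (fun x => g (f x)) := fun m => by
  obtain ⟨fm, h1, h2⟩ := hf m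
  obtain ⟨gm, h3, h4⟩ := hg m
  have h5 : ∀ x, E.emb m x ∈ U → F.emb m (fm x) ∈ V := fun x hx => (h1 x hx).symm ▸ h hx
  exact ⟨fun x => gm (fm x), fun x hx => (h3 _ (h5 x hx)).trans (congrArg g (h1 x hx)),
    h4.comp h2 h5⟩

theorem IsSc.isSc0 : ∀ {n : ℕ}, IsSc n U f → IsSc0 U f
  | 0, h => h
  | _ + 1, h => h.1

theorem IsSc.congr (h : IsSc n U f) (e : Set.EqOn f' f U) : IsSc n U f' := by
  cases n with
  | zero => exact IsSc0.congr h e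
  | succ n =>
    obtain ⟨h0, f₁, D, h1, h2, h3⟩ := h
    refine ⟨h0.congr e, f₁, D, fun x hx => (h1 x hx).trans (e hx).symm, fun x hx => ?_, h3⟩
    exact (h2 x hx).congr (fun y hy => e hy) (e hx)

theorem IsSc.of_succ (h : IsSc (n + 1) U f) : IsSc n U f := by
  induction n generalizing E F with
  | zero => exact h.1
  | succ n ih =>
    obtain ⟨h0, f₁, D, h1, h2, h3⟩ := h
    exact ⟨h0, f₁, D, h1, h2, ih h3⟩

theorem IsSc.mono (h : IsSc n U f) {U' : Set (E.lvl 0)} (hU : U' ⊆ U) : IsSc n U' f := by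
  induction n generalizing E F with
  | zero => exact IsSc0.mono h hU
  | succ n ih =>
    obtain ⟨h0, f₁, D, h1, h2, h3⟩ := h
    exact ⟨h0.mono hU, f₁, D, fun x hx => h1 x (hU hx),
      fun x hx => (h2 x (hU hx)).mono fun y hy => hU hy, ih h3 fun p hp => hU hp⟩

/-- The chain rule: the tangent map of a composition is the composition of the tangent maps. -/
theorem IsSc.comp (hg : IsSc n V g) (hf : IsSc n U f) (hV : IsScDomain F V)
    (h : Set.MapsTo f U V) : IsSc n U (fun x => g (f x)) := by
  induction n generalizing E F H with
  | zero => exact IsSc0.comp hg hf h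
  | succ n ih =>
    obtain ⟨hf0, f₁, Df, hf1, hf2, hf3⟩ := hf
    obtain ⟨hg0, g₁, Dg, hg1, hg2, hg3⟩ := hg
    have hmaps : ∀ x, E.incl 0 x ∈ U → F.incl 0 (f₁ x) ∈ V := fun x hx => (hf1 x hx).symm ▸ h hx
    refine ⟨hg0.comp hf0 h, fun x => g₁ (f₁ x), fun x => (Dg (f₁ x)).comp (Df x),
      fun x hx => (hg1 _ (hmaps x hx)).trans (congrArg g (hf1 x hx)), fun x hx => ?_,
      ih hg3 hf3 hV.tangent fun p hp => hmaps _ hp⟩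
    have hTf := hf3.isSc0.continuousOn
    have hTg := hg3.isSc0.continuousOn
    obtain ⟨O, K, hO, hK, -, hOK⟩ := hV
    have hfc : ContinuousWithinAt f₁ {y | E.incl 0 y ∈ U} x := by
      have h1 : ContinuousOn (fun y : E.lvl 1 => (f₁ y, Df y 0)) {y | E.incl 0 y ∈ U} :=
        hTf.comp (f := fun y : E.lvl 1 => (y, (0 : E.lvl 0))) (by fun_prop) fun y hy => hy
      exact (continuous_fst.comp_continuousOn h1) x hx
    have key := hasFDerivWithinAt_comp_of_compact (E.incl 0) (E.incl_compact 0) (F.incl 0)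
      (S := {y | E.incl 0 y ∈ U}) (V := {z | F.incl 0 z ∈ V}) (f := f₁) (A := Df x)
      (g := fun z => g (F.incl 0 z)) (D := Dg)
      (hO.preimage (F.incl 0).continuous) (hK.linear_preimage (F.incl 0).toLinearMap)
      (by rw [hOK]; rfl) hx (fun y hy => hmaps y hy) hfc
      ((hf2 x hx).congr (fun y hy => hf1 y hy) (hf1 x hx)) hg2
      (continuous_snd.comp_continuousOn hTg)
    exact key.congr (fun y hy => congrArg g (hf1 y hy).symm) (congrArg g (hf1 x hx).symm)

/-- Being of class sc^n is a local property. The derivatives of the local restrictions fit together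
because they are unique: `{y | E.incl 0 y ∈ U}` is a set of unique differentiability, and `E₁` is
dense in `E₀`. -/
theorem IsSc.of_locally (hU : IsScDomain E U)
    (h : ∀ x ∈ U, ∃ O, IsOpen O ∧ x ∈ O ∧ IsSc n (U ∩ O) f) : IsSc n U f := by
  -- The restrictions to the levels are unique, the inclusions being injective.
  have aux : ∀ {E F : ScBanach.{u}} {U : Set (E.lvl 0)} {f : E.lvl 0 → F.lvl 0},
      (∀ x ∈ U, ∃ O, IsOpen O ∧ x ∈ O ∧ IsSc0 (U ∩ O) f) → IsSc0 U f := by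
    intro E F U f h m
    have hex : ∀ x : E.lvl m, ∃ y : F.lvl m, E.emb m x ∈ U → F.emb m y = f (E.emb m x) := by
      intro x
      by_cases hx : E.emb m x ∈ U
      · obtain ⟨O, hO, hxO, hf⟩ := h _ hx
        obtain ⟨fm, h1, h2⟩ := hf m
        exact ⟨fm x, fun _ => h1 x ⟨hx, hxO⟩⟩
      · exact ⟨0, fun h => absurd h hx⟩
    choose fm hfm using hex
    refine ⟨fm, hfm, fun x hx => ?_⟩
    obtain ⟨O, hO, hxO, hf⟩ := h _ hx
    obtain ⟨fm', h1, h2⟩ := hf m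
    have h3 : ContinuousWithinAt fm' ({y | E.emb m y ∈ U} ∩ {y | E.emb m y ∈ O}) x :=
      h2 x ⟨hx, hxO⟩
    replace h3 := (continuousWithinAt_inter
      ((hO.preimage (E.emb m).continuous).mem_nhds hxO)).1 h3
    refine h3.congr_of_eventuallyEq ?_ (F.emb_injective m ((hfm x hx).trans (h1 x ⟨hx, hxO⟩).symm))
    filter_upwards [self_mem_nhdsWithin, mem_nhdsWithin_of_mem_nhds
      ((hO.preimage (E.emb m).continuous).mem_nhds hxO)] with y hy hyO
    exact F.emb_injective m ((hfm y hy).trans (h1 y ⟨hy, hyO⟩).symm)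
  induction n generalizing E F with
  | zero => exact aux h
  | succ n ih =>
    have h0 : IsSc0 U f := aux fun x hx => by
      obtain ⟨O, hO, hxO, hf⟩ := h x hx
      exact ⟨O, hO, hxO, hf.1⟩
    have hex : ∀ x : E.lvl 1, ∃ (y : F.lvl 1) (D : E.lvl 0 →L[ℝ] F.lvl 0), E.incl 0 x ∈ U →
        F.incl 0 y = f (E.incl 0 x) ∧ HasFDerivWithinAt (fun y : E.lvl 1 => f (E.incl 0 y))
          (D.comp (E.incl 0)) {y | E.incl 0 y ∈ U} x := by
      intro x
      by_cases hx : E.incl 0 x ∈ U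
      · obtain ⟨O, hO, hxO, -, f₁, D, h1, h2, -⟩ := h _ hx
        refine ⟨f₁ x, D x, fun _ => ⟨h1 x ⟨hx, hxO⟩, ?_⟩⟩
        exact (hasFDerivWithinAt_inter
          ((hO.preimage (E.incl 0).continuous).mem_nhds hxO)).1 (h2 x ⟨hx, hxO⟩)
      · exact ⟨0, 0, fun h => absurd h hx⟩
    choose f₁ D hfD using hex
    refine ⟨h0, f₁, D, fun x hx => (hfD x hx).1, fun x hx => (hfD x hx).2, ?_⟩
    refine ih hU.tangent fun p hp => ?_
    obtain ⟨O, hO, hpO, -, f₁', D', h1, h2, h3⟩ := h _ hp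
    refine ⟨{p | E.incl 0 p.1 ∈ O}, hO.preimage ((E.incl 0).continuous.comp continuous_fst), hpO,
      h3.congr fun q hq => ?_⟩
    have e1 : f₁ q.1 = f₁' q.1 :=
      F.incl_injective 0 ((hfD q.1 hq.1).1.trans (h1 q.1 hq).symm)
    have e2 : (D q.1).comp (E.incl 0) = (D' q.1).comp (E.incl 0) :=
      (hU.uniqueDiffOn q.1 hq.1).eq (hfD q.1 hq.1).2 ((hasFDerivWithinAt_inter
          ((hO.preimage (E.incl 0).continuous).mem_nhds hq.2)).1 (h2 q.1 hq))
    have e3 : D q.1 = D' q.1 := ContinuousLinearMap.ext fun w =>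
      congrFun ((E.denseRange_incl 0).equalizer (D q.1).continuous (D' q.1).continuous
        (funext fun z => congrArg (fun L => L z) e2)) w
    exact Prod.ext e1 (by rw [e3])

/-- A linear sc-operator, given by its restrictions to all levels, is of class sc^n. -/
theorem IsSc.of_linear (L : ∀ m, E.lvl m →L[ℝ] F.lvl m)
    (hL : ∀ m x, F.incl m (L (m + 1) x) = L m (E.incl m x)) : IsSc n U (L 0) := by
  have h0 : ∀ m x, F.emb m (L m x) = L 0 (E.emb m x) := by
    intro m
    induction m with
    | zero => exact fun x => rfl
    | succ m ih => exact fun x => (congrArg (F.emb m) (hL m x)).trans (ih _)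
  have h0' : IsSc0 U (L 0) := fun m => ⟨L m, fun x _ => h0 m x, (L m).continuous.continuousOn⟩
  induction n generalizing E F with
  | zero => exact h0'
  | succ n ih =>
    refine ⟨h0', L 1, fun _ => L 0, fun x _ => hL 0 x,
      fun x _ => ((L 0).comp (E.incl 0)).hasFDerivWithinAt, ?_⟩
    have hTL : ∀ m (x : E.tangent.lvl (m + 1)),
        F.tangent.incl m (((L (m + 2)).prodMap (L (m + 1))) x) =
        ((L (m + 1)).prodMap (L m)) (E.tangent.incl m x) := fun m x => Prod.ext (hL _ _) (hL _ _)
    have hT0 : ∀ m (x : E.tangent.lvl m), F.tangent.emb m (((L (m + 1)).prodMap (L m)) x) =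
        ((L 1).prodMap (L 0)) (E.tangent.emb m x) := by
      intro m
      induction m with
      | zero => exact fun x => rfl
      | succ m ih => exact fun x => (congrArg (F.tangent.emb m) (hTL m x)).trans (ih _)
    exact ih (E := E.tangent) (F := F.tangent) (fun m => (L (m + 1)).prodMap (L m)) hTL hT0
      (fun m => ⟨(L (m + 1)).prodMap (L m), fun x _ => hT0 m x,
        ((L (m + 1)).prodMap (L m)).continuous.continuousOn⟩)

/-- A constant map whose value is a smooth point is of class sc^n. -/
theorem IsSc.const (c : ∀ m, F.lvl m) (hc : ∀ m, F.incl m (c (m + 1)) = c m) :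
    IsSc (E := E) n U (fun _ => c 0) := by
  have h0 : ∀ {E F : ScBanach.{u}} (U : Set (E.lvl 0)) (c : ∀ m, F.lvl m),
      (∀ m, F.incl m (c (m + 1)) = c m) → IsSc0 (E := E) U (fun _ => c 0) := by
    intro E F U c hc m
    have h : F.emb m (c m) = c 0 := by
      induction m with
      | zero => rfl
      | succ m ih => exact (congrArg (F.emb m) (hc m)).trans ih
    exact ⟨fun _ => c m, fun _ _ => h, continuousOn_const⟩
  induction n generalizing E F with
  | zero => exact h0 U c hc
  | succ n ih =>
    refine ⟨h0 U c hc, fun _ => c 1, fun _ => 0, fun _ _ => hc 0, fun x _ => ?_, ?_⟩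
    · rw [ContinuousLinearMap.zero_comp]; exact hasFDerivWithinAt_const _ _ _
    · exact ih (E := E.tangent) (F := F.tangent) (fun m => (c (m + 1), 0))
        fun m => Prod.ext (hc _) (map_zero (F.incl m))

theorem IsSc.prodMk {g : E.lvl 0 → H.lvl 0} (hf : IsSc n U f) (hg : IsSc n U g) :
    IsSc (F := F.prod H) n U (fun x => (f x, g x)) := by
  have h0 : ∀ {E F H : ScBanach.{u}} {U : Set (E.lvl 0)} {f : E.lvl 0 → F.lvl 0}
      {g : E.lvl 0 → H.lvl 0}, IsSc0 U f → IsSc0 U g →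
      IsSc0 (F := F.prod H) U (fun x => (f x, g x)) := by
    intro E F H U f g hf hg m
    obtain ⟨fm, h1, h2⟩ := hf m
    obtain ⟨gm, h3, h4⟩ := hg m
    exact ⟨fun x => (fm x, gm x), fun x hx => (ScBanach.prod_emb F H m (fm x, gm x)).trans
      (Prod.ext (h1 x hx) (h3 x hx)), h2.prodMk h4⟩
  induction n generalizing E F H with
  | zero => exact h0 hf hg
  | succ n ih =>
    obtain ⟨hf0, f₁, Df, hf1, hf2, hf3⟩ := hf
    obtain ⟨hg0, g₁, Dg, hg1, hg2, hg3⟩ := hg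
    refine ⟨h0 hf0 hg0, fun x => (f₁ x, g₁ x), fun x => (Df x).prod (Dg x),
      fun x hx => Prod.ext (hf1 x hx) (hg1 x hx),
      fun x hx => (hf2 x hx).prodMk (hg2 x hx), ?_⟩
    -- `T(F ⊕ H)` is `TF ⊕ TH` with the summands in a different order.
    let L : ∀ m, (F.tangent.prod H.tangent).lvl m →L[ℝ] (F.prod H).tangent.lvl m := fun m =>
      ((ContinuousLinearMap.fst ℝ (F.lvl (m + 1)) (F.lvl m)).prodMap
        (ContinuousLinearMap.fst ℝ (H.lvl (m + 1)) (H.lvl m))).prod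
      ((ContinuousLinearMap.snd ℝ (F.lvl (m + 1)) (F.lvl m)).prodMap
        (ContinuousLinearMap.snd ℝ (H.lvl (m + 1)) (H.lvl m)))
    exact (IsSc.of_linear (U := Set.univ) L (fun m x => rfl)).comp (ih hf3 hg3) .univ
      (fun _ _ => trivial)

/-- The product of a smooth function on `E₀` and a map of class sc^n is of class sc^n. -/
theorem IsSc.contDiff_smul {β : E.lvl 0 → ℝ} (hβ : ContDiff ℝ ∞ β) (hU : IsScDomain E U)
    (hf : IsSc n U f) : IsSc n U (fun x => β x • f x) := by
  have h0 : ∀ {E F : ScBanach.{u}} {U : Set (E.lvl 0)} {f : E.lvl 0 → F.lvl 0} {β : E.lvl 0 → ℝ},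
      Continuous β → IsSc0 U f → IsSc0 U (fun x => β x • f x) := by
    intro E F U f β hβ hf m
    obtain ⟨fm, h1, h2⟩ := hf m
    exact ⟨fun x => β (E.emb m x) • fm x, fun x hx => by rw [map_smul, h1 x hx],
      (hβ.comp (E.emb m).continuous).continuousOn.smul h2⟩
  induction n generalizing E F with
  | zero => exact h0 hβ.continuous hf
  | succ n ih =>
    have hfsucc := hf
    obtain ⟨hf0, f₁, D, hf1, hf2, hf3⟩ := hf
    refine ⟨h0 hβ.continuous hf0, fun x => β (E.incl 0 x) • f₁ x,
      fun x => β (E.incl 0 x) • D x + (fderiv ℝ β (E.incl 0 x)).smulRight (f (E.incl 0 x)),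
      fun x hx => by rw [map_smul, hf1 x hx], fun x hx => ?_, ?_⟩
    · have h1 : HasFDerivWithinAt (fun y : E.lvl 1 => β (E.incl 0 y))
          ((fderiv ℝ β (E.incl 0 x)).comp (E.incl 0)) {y | E.incl 0 y ∈ U} x :=
        (((hβ.differentiable (by simp)) _).hasFDerivAt.comp x
          (E.incl 0).hasFDerivAt).hasFDerivWithinAt
      exact h1.smul (hf2 x hx)
    · let TU : Set (E.tangent.lvl 0) := {p | E.incl 0 p.1 ∈ U}
      -- The tangent map is the sum of `β • Tf` and `dβ • (0, f)`.
      have h1 : IsSc (E := E.tangent) (F := F.tangent) n TU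
          (fun p => β (E.incl 0 p.1) • (f₁ p.1, D p.1 p.2)) :=
        ih (E := E.tangent) (F := F.tangent)
          (hβ.comp ((E.incl 0).contDiff.comp contDiff_fst)) hU.tangent hf3
      have h2 : IsSc (E := E.tangent) (F := E) n TU (fun p => E.incl 0 p.1) :=
        IsSc.of_linear (E := E.tangent) (F := E)
          (fun m => (E.incl m).comp (ContinuousLinearMap.fst ℝ (E.lvl (m + 1)) (E.lvl m)))
          (fun m x => rfl)
      have h3 : IsSc (E := F) (F := F.tangent) n Set.univ (fun y => (0, y)) :=
        IsSc.of_linear (E := F) (F := F.tangent)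
          (fun m => ContinuousLinearMap.inr ℝ (F.lvl (m + 1)) (F.lvl m))
          (fun m x => Prod.ext (map_zero (F.incl (m + 1))) rfl)
      have h4 : IsSc (E := E.tangent) (F := F.tangent) n TU (fun p => (0, f (E.incl 0 p.1))) :=
        h3.comp (F := F) (hfsucc.of_succ.comp (F := E) h2 hU fun p hp => hp) .univ
          fun _ _ => trivial
      have h5 : IsSc (E := E.tangent) (F := F.tangent) n TU
          (fun p => fderiv ℝ β (E.incl 0 p.1) p.2 • (0, f (E.incl 0 p.1))) := by
        refine ih (E := E.tangent) (F := F.tangent) ?_ hU.tangent h4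
        exact (((contDiff_infty_iff_fderiv.1 hβ).2.comp
          ((E.incl 0).contDiff.comp contDiff_fst)).clm_apply contDiff_snd)
      have h6 : IsSc (E := F.tangent.prod F.tangent) (F := F.tangent) n Set.univ
          (fun q => q.1 + q.2) :=
        IsSc.of_linear (E := F.tangent.prod F.tangent) (F := F.tangent)
          (fun m => ContinuousLinearMap.fst ℝ _ _ + ContinuousLinearMap.snd ℝ _ _)
          (fun m x => (map_add (F.tangent.incl m) x.1 x.2))
      refine (h6.comp (F := F.tangent.prod F.tangent) (h1.prodMk h5) .univ
        fun _ _ => trivial).congr fun p hp => ?_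
      exact Prod.ext (by simp) rfl

end ScCalculus

section ScSmooth

variable {E F H : ScBanach.{u}} {U : Set (E.lvl 0)} {V : Set (F.lvl 0)}
  {f f' : E.lvl 0 → F.lvl 0} {g : F.lvl 0 → H.lvl 0}

theorem IsScSmooth.congr (h : IsScSmooth U f) (e : Set.EqOn f' f U) : IsScSmooth U f' :=
  fun n => (h n).congr e

theorem IsScSmooth.mono (h : IsScSmooth U f) {U' : Set (E.lvl 0)} (hU : U' ⊆ U) :
    IsScSmooth U' f := fun n => (h n).mono hU

theorem IsScSmooth.comp (hg : IsScSmooth V g) (hf : IsScSmooth U f) (hV : IsScDomain F V)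
    (h : Set.MapsTo f U V) : IsScSmooth U (fun x => g (f x)) :=
  fun n => (hg n).comp (hf n) hV h

theorem IsScSmooth.of_locally (hU : IsScDomain E U)
    (h : ∀ x ∈ U, ∃ O, IsOpen O ∧ x ∈ O ∧ IsScSmooth (U ∩ O) f) : IsScSmooth U f :=
  fun n => .of_locally hU fun x hx =>
    let ⟨O, h1, h2, h3⟩ := h x hx
    ⟨O, h1, h2, h3 n⟩

theorem IsScSmooth.continuousOn (h : IsScSmooth U f) : ContinuousOn f U := (h 0).isSc0.continuousOn

theorem IsScSmooth.of_linear (L : ∀ m, E.lvl m →L[ℝ] F.lvl m)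
    (hL : ∀ m x, F.incl m (L (m + 1) x) = L m (E.incl m x)) : IsScSmooth U (L 0) :=
  fun _ => .of_linear L hL

theorem isScSmooth_id : IsScSmooth (E := E) (F := E) U (fun x => x) :=
  .of_linear (fun _ => ContinuousLinearMap.id ℝ _) (fun _ _ => rfl)

theorem isScSmooth_fst {U : Set ((E.prod F).lvl 0)} :
    IsScSmooth (E := E.prod F) (F := E) U (fun p => p.1) :=
  .of_linear (E := E.prod F) (fun m => ContinuousLinearMap.fst ℝ (E.lvl m) (F.lvl m))
    (fun _ _ => rfl)

theorem isScSmooth_snd {U : Set ((E.prod F).lvl 0)} :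
    IsScSmooth (E := E.prod F) (F := F) U (fun p => p.2) :=
  .of_linear (E := E.prod F) (fun m => ContinuousLinearMap.snd ℝ (E.lvl m) (F.lvl m))
    (fun _ _ => rfl)

theorem IsScSmooth.prodMk {g : E.lvl 0 → H.lvl 0} (hf : IsScSmooth U f) (hg : IsScSmooth U g) :
    IsScSmooth (F := F.prod H) U (fun x => (f x, g x)) :=
  fun n => (hf n).prodMk (hg n)

end ScSmooth

/-! ### Sc-smooth maps between M-polyfolds -/

namespace ScBanach

theorem IsPartialQuadrant.isScDomain {W : ScBanach.{u}} {C O : Set (W.lvl 0)}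
    (hC : W.IsPartialQuadrant C) (hO : IsOpen O) : IsScDomain W (O ∩ C) := by
  obtain ⟨n, W', T, hT, rfl⟩ := hC
  refine ⟨O, _, hO, ?_, fun m => ?_, rfl⟩
  · intro x hx y hy a b ha hb _ i
    have h1 := mul_nonneg ha (hx i)
    have h2 := mul_nonneg hb (hy i)
    simpa using add_nonneg h1 h2
  · have h : ∀ x : W.lvl m, (T 0 (W.emb m x)).1 = (T m x).1 := by
      induction m with
      | zero => exact fun x => rfl
      | succ m ih => exact fun x => (ih (W.incl m x)).trans (congrArg Prod.fst (hT m x))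
    refine ⟨(T m).symm (1, 0), mem_interior.2
      ⟨⋂ i, {x | 0 < (T m x).1 i}, fun x hx i => ?_, ?_, ?_⟩⟩
    · rw [h x]; exact (Set.mem_iInter.1 hx i).le
    · exact isOpen_iInter_of_finite fun i => isOpen_lt continuous_const
        ((continuous_apply i).comp (continuous_fst.comp (T m).continuous))
    · simp

end ScBanach

namespace Splicing

variable (S : Splicing.{u})

theorem isScDomain : IsScDomain S.amb {q | q.1 ∈ S.V} := by
  obtain ⟨O, hO, hV⟩ := S.V_open
  rw [hV]
  exact (S.quadrant.isScDomain hO).prod_univ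

theorem isScSmooth_ret : IsScSmooth (E := S.amb) (F := S.amb) {q | q.1 ∈ S.V} S.ret :=
  isScSmooth_fst.prodMk S.smooth

theorem ret_mem_core {q : S.amb.lvl 0} (hq : q.1 ∈ S.V) : S.ret q ∈ S.core :=
  ⟨hq, S.idem _ hq _⟩

theorem ret_eq_self {q : S.amb.lvl 0} (hq : q ∈ S.core) : S.ret q = q :=
  Prod.ext rfl hq.2

end Splicing

namespace MPChart

variable {X : Type v} {Y : Type w} {Z : Type z} [TopologicalSpace X] [TopologicalSpace Y]
  [TopologicalSpace Z]

/-- The representation of a map in two charts, precomposed with the retraction onto the splicing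
core. -/
noncomputable def rep (c : MPChart.{u} X) (d : MPChart.{u} Y) (f : X → Y) :
    c.S.amb.lvl 0 → d.S.amb.lvl 0 :=
  fun q => d.φ (f (c.φ.symm (c.S.ret q)))

variable (c : MPChart.{u} X) (d : MPChart.{u} Y)

theorem target_subset_core : c.φ.target ⊆ c.S.core := by
  obtain ⟨O, -, h⟩ := c.open_target
  rw [h]; exact Set.inter_subset_right

theorem pull_mono {A B : Set X} (h : A ∩ c.φ.source ⊆ B) : c.pull A ⊆ c.pull B :=
  fun _ hq => ⟨hq.1, hq.2.1, h ⟨hq.2.2, c.φ.map_target hq.2.1⟩⟩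

theorem apply_mem_pull {A : Set X} {x : X} (hx : x ∈ c.φ.source) (hA : x ∈ A) :
    c.φ x ∈ c.pull A := by
  have h1 := c.φ.map_source hx
  have h2 := c.target_subset_core h1
  refine ⟨h2.1, ?_, ?_⟩
  · rwa [c.S.ret_eq_self h2]
  · rwa [c.S.ret_eq_self h2, c.φ.left_inv hx]

theorem symm_ret_apply {x : X} (hx : x ∈ c.φ.source) : c.φ.symm (c.S.ret (c.φ x)) = x := by
  rw [c.S.ret_eq_self (c.target_subset_core (c.φ.map_source hx)), c.φ.left_inv hx]

theorem continuousOn_symm_ret : ContinuousOn (fun q => c.φ.symm (c.S.ret q)) (c.pull Set.univ) :=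
  c.cont_symm.comp (c.S.isScSmooth_ret.continuousOn.mono fun _ hq => hq.1) fun _ hq => hq.2.1

/-- The part of `V ⊕ E` over an open set is relatively open. -/
theorem pull_inter_eq {A : Set X} (B : Set X) (hA : IsOpen A) : ∃ O, IsOpen O ∧
    c.pull (B ∩ A) = c.pull B ∩ O := by
  obtain ⟨O, hO, h⟩ := continuousOn_iff'.1 c.continuousOn_symm_ret A hA
  refine ⟨O, hO, Set.ext fun q => ⟨fun hq => ⟨⟨hq.1, hq.2.1, hq.2.2.1⟩, ?_⟩, fun hq => ?_⟩⟩
  · exact (h.subset ⟨hq.2.2.2, hq.1, hq.2.1, trivial⟩).1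
  · exact ⟨hq.1.1, hq.1.2.1, hq.1.2.2, (h.superset ⟨hq.2, hq.1.1, hq.1.2.1, trivial⟩).1⟩

theorem isScDomain_pull {A : Set X} (hA : IsOpen A) : IsScDomain c.S.amb (c.pull A) := by
  have h1 : IsScDomain c.S.amb (c.pull Set.univ) := by
    obtain ⟨O, hO, h⟩ := c.open_target
    obtain ⟨O', hO', h'⟩ := continuousOn_iff'.1 c.S.isScSmooth_ret.continuousOn O hO
    have : c.pull Set.univ = {q | q.1 ∈ c.S.V} ∩ O' := by
      rw [Set.inter_comm, ← h', Set.inter_comm]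
      refine Set.ext fun q => ⟨fun hq => ⟨hq.1, (h ▸ hq.2.1 : _ ∈ O ∩ c.S.core).1⟩, fun hq => ?_⟩
      exact ⟨hq.1, h ▸ ⟨hq.2, c.S.ret_mem_core hq.1⟩, trivial⟩
    rw [this]
    exact c.S.isScDomain.inter hO'
  obtain ⟨O, hO, h⟩ := c.pull_inter_eq Set.univ hA
  rw [Set.univ_inter] at h
  exact h ▸ h1.inter hO

variable {c d}

/-- A map on the part of a chart over an open set is sc-smooth if it is so near every point. -/
theorem isScSmooth_pull_of_locally {F : ScBanach.{u}} {f : c.S.amb.lvl 0 → F.lvl 0} {A : Set X}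
    (hA : IsOpen A) (h : ∀ x ∈ A, x ∈ c.φ.source → ∃ A', IsOpen A' ∧ x ∈ A' ∧
      IsScSmooth (c.pull (A ∩ A')) f) : IsScSmooth (c.pull A) f := by
  refine .of_locally (c.isScDomain_pull hA) fun q hq => ?_
  obtain ⟨A', h1, h2, h3⟩ := h _ hq.2.2 (c.φ.map_target hq.2.1)
  obtain ⟨O, hO, hO'⟩ := c.pull_inter_eq A h1
  refine ⟨O, hO, ?_, hO' ▸ h3⟩
  exact (hO'.subset ⟨hq.1, hq.2.1, hq.2.2, h2⟩).2

/-- Representations of maps in charts compose, because the retraction of the middle chart is the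
identity on the image of the chart. -/
theorem isScSmooth_rep_comp {e : MPChart.{u} Z} {f : X → Y} {g : Y → Z} {A : Set X} {B : Set Y}
    (hB : IsOpen B) (hg : IsScSmooth (d.pull B) (d.rep e g))
    (hf : IsScSmooth (c.pull A) (c.rep d f))
    (h : ∀ x ∈ A, x ∈ c.φ.source → f x ∈ B ∧ f x ∈ d.φ.source) :
    IsScSmooth (c.pull A) (c.rep e (fun x => g (f x))) := by
  have h' : ∀ q ∈ c.pull A, f (c.φ.symm (c.S.ret q)) ∈ B ∧ f (c.φ.symm (c.S.ret q)) ∈ d.φ.source :=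
    fun q hq => h _ hq.2.2 (c.φ.map_target hq.2.1)
  refine (hg.comp hf (d.isScDomain_pull hB) fun q hq =>
    d.apply_mem_pull (h' q hq).2 (h' q hq).1).congr fun q hq => ?_
  exact congrArg (fun y => e.φ (g y)) (d.symm_ret_apply (h' q hq).2).symm

end MPChart

namespace MPolyfold

variable {X : Type v} {Y : Type w} {Z : Type z} [TopologicalSpace X] [TopologicalSpace Y]
  [TopologicalSpace Z] {M : MPolyfold.{u} X} {N : MPolyfold.{u} Y} {R : MPolyfold.{u} Z}
  {U : Set X} {V : Set Y} {f f' : X → Y} {g : Y → Z}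

/-- A chart is compatible with an M-polyfold structure if the transition maps to and from all charts
of the atlas are sc-smooth. -/
def Compatible (M : MPolyfold.{u} X) (c : MPChart.{u} X) : Prop :=
  ∀ d ∈ M.atlas, c.Transition d ∧ d.Transition c

theorem ScSmoothOn.mono (h : M.ScSmoothOn N U f) {U' : Set X} (hU : U' ⊆ U) :
    M.ScSmoothOn N U' f :=
  ⟨h.1.mono hU, fun c hc d hd => (h.2 c hc d hd).mono
    (c.pull_mono fun _ hx => ⟨hU hx.1.1, hx.1.2⟩)⟩

theorem ScSmoothOn.congr (h : M.ScSmoothOn N U f) (e : Set.EqOn f' f U) :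
    M.ScSmoothOn N U f' := by
  refine ⟨h.1.congr e, fun c hc d hd => ?_⟩
  refine ((h.2 c hc d hd).mono (c.pull_mono fun x hx => ⟨hx.1.1, ?_⟩)).congr fun q hq => ?_
  · exact (e hx.1.1 ▸ hx.1.2 : f x ∈ d.φ.source)
  · exact congrArg d.φ (e hq.2.2.1)

/-- The representation of an sc-smooth map in compatible charts is sc-smooth. -/
theorem ScSmoothOn.isScSmooth_rep (h : M.ScSmoothOn N U f) (hU : IsOpen U) {c : MPChart.{u} X}
    {d : MPChart.{u} Y} (hc : M.Compatible c) (hd : N.Compatible d) :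
    IsScSmooth (c.pull (U ∩ f ⁻¹' d.φ.source)) (c.rep d f) := by
  refine MPChart.isScSmooth_pull_of_locally (h.1.isOpen_inter_preimage hU d.open_source)
    fun x hx hxc => ?_
  obtain ⟨c', hc', hxc'⟩ := M.cover x
  obtain ⟨d', hd', hxd'⟩ := N.cover (f x)
  refine ⟨c'.φ.source ∩ (U ∩ f ⁻¹' d'.φ.source),
    c'.open_source.inter (h.1.isOpen_inter_preimage hU d'.open_source), ⟨hxc', hx.1, hxd'⟩, ?_⟩
  have h1 : IsScSmooth (c.pull (c'.φ.source ∩ (U ∩ f ⁻¹' d'.φ.source))) (c.rep d' f) :=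
    MPChart.isScSmooth_rep_comp (d := c') (f := fun x => x)
      (h.1.isOpen_inter_preimage hU d'.open_source) (h.2 c' hc' d' hd')
      ((hc c' hc').1.mono (c.pull_mono fun y hy => hy.1.1)) fun y hy _ => ⟨hy.2, hy.1⟩
  exact MPChart.isScSmooth_rep_comp (d := d') (g := fun y => y) d.open_source (hd d' hd').2
    (h1.mono (c.pull_mono fun y hy => hy.1.2)) fun y hy _ => ⟨hy.1.2, hy.2.2.2⟩

theorem ScSmoothOn.comp (hg : N.ScSmoothOn R V g) (hf : M.ScSmoothOn N U f) (hV : IsOpen V)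
    (hU : IsOpen U) (h : Set.MapsTo f U V) : M.ScSmoothOn R U (fun x => g (f x)) := by
  have hc := hg.1.comp hf.1 h
  refine ⟨hc, fun c hcM e he => ?_⟩
  refine MPChart.isScSmooth_pull_of_locally (hc.isOpen_inter_preimage hU e.open_source)
    fun x hx hxc => ?_
  obtain ⟨d, hd, hxd⟩ := N.cover (f x)
  refine ⟨U ∩ f ⁻¹' d.φ.source, hf.1.isOpen_inter_preimage hU d.open_source, ⟨hx.1, hxd⟩, ?_⟩
  exact MPChart.isScSmooth_rep_comp (d := d) (hg.1.isOpen_inter_preimage hV e.open_source)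
    (hg.2 d hd e he) ((hf.2 c hcM d hd).mono (c.pull_mono fun y hy => hy.1.2))
    fun y hy _ => ⟨⟨h hy.1.1, hy.1.2⟩, hy.2.2⟩

end MPolyfold

/-! ### Local sections of the source map -/

/-- A morphism as an arrow starting at a prescribed object. -/
def Mor.toOut {X : Type v} [Groupoid.{w} X] (m : Mor X) {y : X} (h : m.src = y) :
    Σ y' : X, (y ⟶ y') :=
  h ▸ ⟨m.tgt, m.hom⟩

theorem Mor.mk_toOut {X : Type v} [Groupoid.{w} X] (m : Mor X) {y : X} (h : m.src = y) :
    (⟨y, (m.toOut h).1, (m.toOut h).2⟩ : Mor X) = m := by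
  subst h; rfl

theorem Mor.mk_inj {X : Type v} [Groupoid.{w} X] {y : X} {p q : Σ y' : X, (y ⟶ y')}
    (h : (⟨y, p.1, p.2⟩ : Mor X) = ⟨y, q.1, q.2⟩) : p = q := by
  obtain ⟨p1, p2⟩ := p
  obtain ⟨q1, q2⟩ := q
  injection h with h1 h2 h3
  exact Sigma.ext h2 h3

namespace EpGroupoid

variable {X : Type v} [TopologicalSpace X] [Groupoid.{w} X] [TopologicalSpace (Mor X)]
  {G : EpGroupoid.{u} X}

/-- A local section `a` of the source map on an open set `V`, passing through the morphism `m` and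
containing all morphisms close to `m`, together with a local section `a'` on `V'` consisting of the
inverse morphisms. -/
structure IsBisection (G : EpGroupoid.{u} X) (m : Mor X) (a a' : SrcSection X) (V V' : Set X) :
    Prop where
  isOpen : IsOpen V
  isOpen' : IsOpen V'
  mem : m.src ∈ V
  smooth : G.ob.ScSmoothOn G.mor V a.toMor
  smooth' : G.ob.ScSmoothOn G.mor V' a'.toMor
  smooth_tgt : G.ob.ScSmoothOn G.ob V (fun y => (a y).1)
  apply_src : a.toMor m.src = m
  eventually_eq : ∀ᶠ h in 𝓝 m, a.toMor h.src = h
  mapsTo : ∀ y ∈ V, (a y).1 ∈ V'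
  apply_apply : ∀ y ∈ V, a' (a y).1 = ⟨y, Groupoid.inv (a y).2⟩

theorem continuous_src (G : EpGroupoid.{u} X) : Continuous (Mor.src : Mor X → X) :=
  continuous_iff_continuousAt.2 fun m => by
    obtain ⟨e, hm, he, -⟩ := G.src_diffeo m
    exact (e.continuousAt hm).congr
      (mem_of_superset (e.open_source.mem_nhds hm) fun y hy => (he hy).symm)

theorem continuous_tgt (G : EpGroupoid.{u} X) : Continuous (Mor.tgt : Mor X → X) :=
  continuous_iff_continuousAt.2 fun m => by
    obtain ⟨e, hm, he, -⟩ := G.tgt_diffeo m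
    exact (e.continuousAt hm).congr
      (mem_of_superset (e.open_source.mem_nhds hm) fun y hy => (he hy).symm)

theorem exists_isBisection (G : EpGroupoid.{u} X) (m : Mor X) {D D' : Set X} (hD : D ∈ 𝓝 m.src)
    (hD' : D' ∈ 𝓝 m.tgt) : ∃ a a' V V', G.IsBisection m a a' V V' ∧ V ⊆ D ∧ V' ⊆ D' := by
  classical
  obtain ⟨es, hms, hes, hes1, hes2⟩ := G.src_diffeo m
  obtain ⟨et, hmt, het, het1, het2⟩ := G.tgt_diffeo m
  -- On the open set `O` both the source and the target map are injective; `a` and `a'` are the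
  -- inverse of the former, and the inverse of the latter followed by inversion.
  let O : Set (Mor X) := es.source ∩ et.source ∩
    (Mor.src ⁻¹' interior D ∩ Mor.tgt ⁻¹' interior D')
  have hO : IsOpen O := (es.open_source.inter et.open_source).inter
    ((isOpen_interior.preimage G.continuous_src).inter (isOpen_interior.preimage G.continuous_tgt))
  have hmO : m ∈ O := ⟨⟨hms, hmt⟩, mem_interior_iff_mem_nhds.2 hD, mem_interior_iff_mem_nhds.2 hD'⟩
  have hOs : O ⊆ es.source := fun h hh => hh.1.1
  have hOt : O ⊆ et.source := fun h hh => hh.1.2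
  let a : SrcSection X := fun y =>
    if h : (es.symm y).src = y then (es.symm y).toOut h else ⟨y, 𝟙 y⟩
  let a' : SrcSection X := fun y =>
    if h : (et.symm y).tgt = y then
      (⟨(et.symm y).tgt, (et.symm y).src, Groupoid.inv (et.symm y).hom⟩ : Mor X).toOut h
    else ⟨y, 𝟙 y⟩
  have ha : ∀ h ∈ O, a.toMor h.src = h := by
    intro h hh
    have h1 : es.symm h.src = h := by rw [hes (hOs hh)]; exact es.left_inv (hOs hh)
    have h2 : (es.symm h.src).src = h.src := by rw [h1]
    have h3 : a h.src = (es.symm h.src).toOut h2 := dif_pos h2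
    rw [SrcSection.toMor, h3, Mor.mk_toOut, h1]
  have ha' : ∀ h ∈ O, a'.toMor h.tgt = ⟨h.tgt, h.src, Groupoid.inv h.hom⟩ := by
    intro h hh
    have h1 : et.symm h.tgt = h := by rw [het (hOt hh)]; exact et.left_inv (hOt hh)
    have h2 : (et.symm h.tgt).tgt = h.tgt := by rw [h1]
    have h3 : a' h.tgt = (⟨(et.symm h.tgt).tgt, (et.symm h.tgt).src,
      Groupoid.inv (et.symm h.tgt).hom⟩ : Mor X).toOut h2 := dif_pos h2
    rw [SrcSection.toMor, h3, Mor.mk_toOut, h1]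
  have hVs : Mor.src '' O = es '' O := Set.image_congr fun h hh => hes (hOs hh)
  have hVt : Mor.tgt '' O = et '' O := Set.image_congr fun h hh => het (hOt hh)
  have hV : IsOpen (Mor.src '' O) := hVs ▸ es.isOpen_image_of_subset_source hO hOs
  have hV' : IsOpen (Mor.tgt '' O) := hVt ▸ et.isOpen_image_of_subset_source hO hOt
  have hVsub : Mor.src '' O ⊆ es.target :=
    hVs ▸ (Set.image_mono hOs).trans es.image_source_eq_target.subset
  have hVsub' : Mor.tgt '' O ⊆ et.target :=
    hVt ▸ (Set.image_mono hOt).trans et.image_source_eq_target.subset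
  have hsm : G.ob.ScSmoothOn G.mor (Mor.src '' O) a.toMor := by
    refine (hes2.mono hVsub).congr ?_
    rintro _ ⟨h, hh, rfl⟩
    rw [ha h hh, hes (hOs hh)]; exact (es.left_inv (hOs hh)).symm
  refine ⟨a, a', Mor.src '' O, Mor.tgt '' O, ⟨hV, hV', ⟨m, hmO, rfl⟩, hsm, ?_, ?_, ha m hmO,
    mem_of_superset (hO.mem_nhds hmO) ha, ?_, ?_⟩, ?_, ?_⟩
  · refine (G.inv_smooth.comp (het2.mono hVsub') isOpen_univ hV' fun _ _ => trivial).congr ?_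
    rintro _ ⟨h, hh, rfl⟩
    have h1 : et.symm h.tgt = h := by rw [het (hOt hh)]; exact et.left_inv (hOt hh)
    show a'.toMor h.tgt = ⟨(et.symm h.tgt).tgt, (et.symm h.tgt).src,
      Groupoid.inv (et.symm h.tgt).hom⟩
    rw [ha' h hh, h1]
  · refine (het1.comp (g := et) hsm et.open_source hV ?_).congr ?_
    · rintro _ ⟨h, hh, rfl⟩
      rw [ha h hh]; exact hOt hh
    · rintro _ ⟨h, hh, rfl⟩
      show (a.toMor h.src).tgt = et (a.toMor h.src)
      rw [ha h hh]; exact het (hOt hh)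
  · rintro _ ⟨h, hh, rfl⟩
    exact ⟨h, hh, (congrArg Mor.tgt (ha h hh)).symm⟩
  · rintro _ ⟨h, hh, rfl⟩
    refine Mor.mk_inj ?_
    have h1 : ∀ h' : Mor X, h' = h → a'.toMor h'.tgt = ⟨h'.tgt, h'.src, Groupoid.inv h'.hom⟩ := by
      rintro h' rfl; exact ha' h' hh
    exact h1 _ (ha h hh)
  · rintro _ ⟨h, hh, rfl⟩
    exact interior_subset hh.2.1
  · rintro _ ⟨h, hh, rfl⟩
    exact interior_subset hh.2.2

/-- A continuous section of the source map through `m` agrees with the given one near the source of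
`m`. -/
theorem IsBisection.eventually_eq_of_continuousAt {m : Mor X} {a a' : SrcSection X} {V V' : Set X}
    (h : G.IsBisection m a a' V V') {b : SrcSection X} (hb : ContinuousAt b.toMor m.src)
    (hbm : b.toMor m.src = m) : ∀ᶠ y in 𝓝 m.src, b y = a y := by
  have h1 : Tendsto b.toMor (𝓝 m.src) (𝓝 m) := by simpa only [ContinuousAt, hbm] using hb
  filter_upwards [h1.eventually h.eventually_eq] with y hy
  exact Mor.mk_inj hy.symm

/-! ### Isotropy groups and natural representations -/

theorem finite_isotropy (G : EpGroupoid.{u} X) (x : X) : Finite (x ⟶ x) := by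
  have := G.ob.t2
  have := G.mor.t2
  obtain ⟨V, hV, hxV, hprop⟩ := G.proper x
  have h1 := (hprop.isCompact_preimage (isCompact_singleton (x := x))).image continuous_subtype_val
  have h2 : IsCompact {m : Mor X | m.src = x ∧ m.tgt = x} := by
    refine h1.of_isClosed_subset ((isClosed_singleton.preimage G.continuous_src).inter
      (isClosed_singleton.preimage G.continuous_tgt)) ?_
    rintro m ⟨hm, hm'⟩
    exact ⟨⟨m, subset_closure (hm.symm ▸ hxV)⟩, hm', rfl⟩
  -- Near each isotropy there is no other one, since it lies on a section of the source map.
  choose a a' W W' hb _ _ using fun m : Mor X => G.exists_isBisection m univ_mem univ_mem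
  obtain ⟨t, -, ht⟩ := h2.elim_nhds_subcover _ fun m _ => (hb m).eventually_eq
  have h3 : {m : Mor X | m.src = x ∧ m.tgt = x} ⊆
      ((fun m => (a m).toMor x) '' (t : Set (Mor X))) := by
    intro m hm
    obtain ⟨m', hm', h⟩ := Set.mem_iUnion₂.1 (ht hm)
    exact ⟨m', hm', by have h : (a m').toMor m.src = m := h; rw [hm.1] at h; exact h⟩
  have h4 : {m : Mor X | m.src = x ∧ m.tgt = x}.Finite := (t.finite_toSet.image _).subset h3
  have := h4.to_subtype
  refine Finite.of_injective (fun g : x ⟶ x =>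
    (⟨⟨x, x, g⟩, rfl, rfl⟩ : {m : Mor X | m.src = x ∧ m.tgt = x})) fun g g' h => ?_
  have h5 : (⟨x, x, g⟩ : Mor X) = ⟨x, x, g'⟩ := congrArg Subtype.val h
  injection h5

/-- By properness, a neighborhood of the isotropy group of `x` contains all morphisms between points
close to `x`. -/
theorem exists_forall_mor_mem (G : EpGroupoid.{u} X) (x : X) {O : Set (Mor X)}
    (hO : IsOpen O)   (h : ∀ g : x ⟶ x, (⟨x, x, g⟩ : Mor X) ∈ O) :
    ∃ D, IsOpen D ∧ x ∈ D ∧ ∀ m : Mor X, m.src ∈ D → m.tgt ∈ D → m ∈ O := by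
  have := G.ob.t2
  obtain ⟨V, hV, hxV, hprop⟩ := G.proper x
  by_contra! hcon
  let st : {g : Mor X // g.src ∈ closure V} → X × X := fun g => (g.1.src, g.1.tgt)
  let C : Set {g : Mor X // g.src ∈ closure V} := {g | g.1 ∉ O}
  have hC : IsClosed C := (hO.preimage continuous_subtype_val).isClosed_compl
  -- If morphisms outside `O` had both ends arbitrarily close to `x`, they would accumulate, by
  -- properness, at an isotropy of `x` outside `O`.
  let ℱ := comap st (𝓝 (x, x)) ⊓ 𝓟 C
  have hne : NeBot ℱ := by
    refine inf_principal_neBot_iff.2 fun S hS => ?_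
    obtain ⟨T, hT, hTS⟩ := mem_comap.1 hS
    obtain ⟨A, hA, B, hB, hAB⟩ := mem_nhds_prod_iff.1 hT
    obtain ⟨D, hDsub, hD, hxD⟩ := mem_nhds_iff.1 (inter_mem (inter_mem hA hB) (hV.mem_nhds hxV))
    obtain ⟨m, hm1, hm2, hm3⟩ := hcon D hD hxD
    exact ⟨⟨m, subset_closure (hDsub hm1).2⟩,
      hTS (hAB (Set.mk_mem_prod (hDsub hm1).1.1 (hDsub hm2).1.2)), hm3⟩
  have hst : Tendsto st ℱ (𝓝 (x, x)) := tendsto_comap.mono_left inf_le_left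
  have hs : Tendsto (fun g : {g : Mor X // g.src ∈ closure V} => g.1.src) ℱ (𝓝 x) :=
    (continuous_fst.tendsto (x, x)).comp hst
  have ht : Tendsto (fun g : {g : Mor X // g.src ∈ closure V} => g.1.tgt) ℱ (𝓝 x) :=
    (continuous_snd.tendsto (x, x)).comp hst
  obtain ⟨g, hg, hcl⟩ := hprop.clusterPt_of_mapClusterPt (ℱ := ℱ) (y := x) ht.mapClusterPt
  have hgC : g ∈ C := isClosed_iff_clusterPt.1 hC g (hcl.mono inf_le_right)
  have hgs : g.1.src = x := by
    have : NeBot (𝓝 g ⊓ ℱ) := hcl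
    exact tendsto_nhds_unique (((G.continuous_src.comp continuous_subtype_val).tendsto g).mono_left
      inf_le_left) (hs.mono_left inf_le_right)
  obtain ⟨⟨s, t, k⟩, hg'⟩ := g
  subst hg
  obtain rfl : s = t := hgs
  exact hgC (h k)

/-- The saturation of a closed set inside a small neighborhood is closed. -/
theorem exists_isClosed_saturation (G : EpGroupoid.{u} X) (x : X) : ∃ V : Set X, IsOpen V ∧ x ∈ V ∧
    ∀ A ⊆ V, IsClosed A → IsClosed {y : X | ∃ y' ∈ A, Nonempty (y ⟶ y')} := by
  obtain ⟨V, hV, hxV, hprop⟩ := G.proper x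
  refine ⟨V, hV, hxV, fun A hA hAc => ?_⟩
  have h1 := hprop.isClosedMap _
    (hAc.preimage (G.continuous_src.comp
      (continuous_subtype_val (p := fun g : Mor X => g.src ∈ closure V))))
  convert h1 using 1
  ext y
  constructor
  · rintro ⟨y', hy', ⟨k⟩⟩
    exact ⟨⟨⟨y', y, Groupoid.inv k⟩, subset_closure (hA hy')⟩, hy', rfl⟩
  · rintro ⟨g, hg, rfl⟩
    exact ⟨_, hg, ⟨Groupoid.inv g.1.hom⟩⟩

/-- Every object has arbitrarily small open neighborhoods on which its isotropy group acts by the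
natural representation. -/
theorem exists_hasNaturalRep (G : EpGroupoid.{u} X) (x : X) {D : Set X} (hD : D ∈ 𝓝 x) :
    ∃ U ⊆ D, G.HasNaturalRep x U := by
  have := G.ob.t2
  have := G.mor.t2
  have := G.finite_isotropy x
  choose a a' V V' hb _ _ using fun g : x ⟶ x =>
    G.exists_isBisection ⟨x, x, g⟩ univ_mem univ_mem
  have hx : ∀ g, a g x = ⟨x, g⟩ := fun g => Mor.mk_inj (hb g).apply_src
  have hcont : ∀ g, ContinuousAt (a g).toMor x := fun g =>
    (hb g).smooth.1.continuousAt ((hb g).isOpen.mem_nhds (hb g).mem)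
  have hcont_tgt : ∀ g, ContinuousAt (fun y => (a g y).1) x := fun g =>
    (hb g).smooth_tgt.1.continuousAt ((hb g).isOpen.mem_nhds (hb g).mem)
  have hdom : ∀ᶠ y in 𝓝 x, ∀ g, y ∈ V g :=
    eventually_all.2 fun g => (hb g).isOpen.mem_nhds (hb g).mem
  have hinj : ∀ᶠ y in 𝓝 x, ∀ g g', g ≠ g' → (a g).toMor y ≠ (a g').toMor y := by
    refine eventually_all.2 fun g => eventually_all.2 fun g' => ?_
    by_cases h : g = g'
    · exact Eventually.of_forall fun y h' => absurd h h'
    have h1 : (a g).toMor x ≠ (a g').toMor x := by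
      rw [(hb g).apply_src, (hb g').apply_src]
      intro h2; injection h2; contradiction
    exact (((hcont g).prodMk (hcont g')).eventually
      (isClosed_diagonal.isOpen_compl.eventually_mem h1)).mono fun y hy _ => hy
  have hmul : ∀ᶠ y in 𝓝 x, ∀ g h, (a (h ≫ g) y).1 = (a g (a h y).1).1 := by
    refine eventually_all.2 fun g => eventually_all.2 fun h => ?_
    let b : SrcSection X := fun y => ⟨(a g (a h y).1).1, (a h y).2 ≫ (a g (a h y).1).2⟩
    have hbx : b x = ⟨x, h ≫ g⟩ := by
      have h1 : ∀ p : Σ y', (x ⟶ y'), p = ⟨x, h⟩ →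
          (⟨(a g p.1).1, p.2 ≫ (a g p.1).2⟩ : Σ y', (x ⟶ y')) = ⟨x, h ≫ g⟩ := by
        rintro _ rfl
        show (⟨(a g x).1, h ≫ (a g x).2⟩ : Σ y', (x ⟶ y')) = _
        rw [hx g]
      exact h1 _ (hx h)
    have hbc : ContinuousAt b.toMor x := by
      have h1 := (G.mul_smooth (V g) (a g) (hb g).isOpen (hb g).smooth).1
      have hm : (a h).toMor x ∈ Mor.tgt ⁻¹' V g := by
        rw [(hb h).apply_src]; exact (hb g).mem
      exact ContinuousAt.comp (g := fun k : Mor X => (⟨k.src, (a g k.tgt).1,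
        k.hom ≫ (a g k.tgt).2⟩ : Mor X)) (h1.continuousAt
          (((hb g).isOpen.preimage G.continuous_tgt).mem_nhds hm)) (hcont h)
    have hbm : b.toMor x = ⟨x, x, h ≫ g⟩ := by rw [SrcSection.toMor, hbx]
    filter_upwards [(hb (h ≫ g)).eventually_eq_of_continuousAt hbc hbm] with y hy
    exact congrArg Sigma.fst hy.symm
  have hone : ∀ᶠ y in 𝓝 x, (a (𝟙 x) y).1 = y := by
    have h1 := (hb (𝟙 x)).eventually_eq_of_continuousAt (b := fun y => ⟨y, 𝟙 y⟩)
      (G.unit_smooth.1.continuousAt univ_mem) rfl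
    filter_upwards [h1] with y hy
    exact congrArg Sigma.fst hy.symm
  obtain ⟨D₁, hD₁, hxD₁, hall⟩ := G.exists_forall_mor_mem x
    (O := interior {m | ∃ g, (a g).toMor m.src = m}) isOpen_interior fun g =>
      mem_interior_iff_mem_nhds.2 ((hb g).eventually_eq.mono fun m hm => ⟨g, hm⟩)
  obtain ⟨D₂, hD₂sub, hD₂, hxD₂⟩ := eventually_nhds_iff.1
    (((hdom.and hinj).and (hmul.and hone)).and
      ((hD₁.eventually_mem hxD₁).and (eventually_mem_set.2 hD)))
  have hτ : ∀ g, ContinuousOn (fun y => (a g y).1) D₂ := fun g =>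
    (hb g).smooth_tgt.1.mono fun y hy => (hD₂sub y hy).1.1.1 g
  -- Shrinking to the points that all isotropies keep in `D₂` makes the neighborhood invariant.
  let U : Set X := D₂ ∩ ⋂ g, D₂ ∩ (fun y => (a g y).1) ⁻¹' D₂
  have hUmem : ∀ y, y ∈ U ↔ y ∈ D₂ ∧ ∀ g, (a g y).1 ∈ D₂ := fun y => by
    simp only [U, Set.mem_inter_iff, Set.mem_iInter, Set.mem_preimage]
    exact ⟨fun h => ⟨h.1, fun g => (h.2 g).2⟩, fun h => ⟨h.1, fun g => ⟨h.1, h.2 g⟩⟩⟩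
  have hUV : ∀ g, U ⊆ V g := fun g y hy => (hD₂sub y hy.1).1.1.1 g
  refine ⟨U, fun y hy => (hD₂sub y hy.1).2.2, ?_, ?_, a, fun g => (hb g).smooth.mono (hUV g), hx,
    ?_, fun g => (hb g).smooth_tgt.mono (hUV g), fun y hy => (hD₂sub y hy.1).1.2.2,
    fun g h y hy => (hD₂sub y hy.1).1.2.1 g h, ?_⟩
  · exact hD₂.inter (isOpen_iInter_of_finite fun g => (hτ g).isOpen_inter_preimage hD₂ hD₂)
  · exact (hUmem x).2 ⟨hxD₂, fun g => by rw [hx g]; exact hxD₂⟩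
  · intro g y hy
    refine (hUmem _).2 ⟨((hUmem y).1 hy).2 g, fun g' => ?_⟩
    rw [← (hD₂sub y hy.1).1.2.1 g' g]
    exact ((hUmem y).1 hy).2 _
  · intro y hy y' hy' h
    obtain ⟨g, hg⟩ := interior_subset
      (hall ⟨y, y', h⟩ (hD₂sub y hy.1).2.1 (hD₂sub y' hy'.1).2.1)
    refine ⟨g, Mor.mk_inj hg, fun g' hg' => ?_⟩
    by_contra hne
    refine (hD₂sub y hy.1).1.1.2 g' g hne ?_
    rw [hg, SrcSection.toMor, hg']

end EpGroupoid

/-! ### Sc⁺-sections in strong bundle charts -/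

namespace BundleChart

variable {X : Type v} [TopologicalSpace X] {Fib : X → Type z}
  [∀ x, AddCommGroup (Fib x)] [∀ x, Module ℝ (Fib x)] [TopologicalSpace (Tot Fib)]
  {b b' : BundleChart.{u} Fib}

theorem mem_source {b : BundleChart.{u} Fib} {x : X} (hx : x ∈ b.base.φ.source) (a : Fib x) :
    (⟨x, a⟩ : Tot Fib) ∈ b.Φ.source := by
  rw [b.source_eq]; exact hx

theorem proj_mem_source {e : Tot Fib} (he : e ∈ b.Φ.source) : e.proj ∈ b.base.φ.source := by
  rw [b.source_eq] at he; exact he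

theorem ret_apply {e : Tot Fib} (he : e ∈ b.Φ.source) : b.ret (b.Φ e) = b.Φ e := by
  have h1 := b.Φ.map_source he
  rw [b.target_eq] at h1
  have h2 := b.base.S.ret_eq_self (b.base.target_subset_core h1.1)
  exact Prod.ext h2 ((congrArg (fun p => b.R.ρ p (b.Φ e).2) h2).trans h1.2)

/-- The section `s` is of class sc⁺ in the chart `b` over `A`. -/
def IsScPlusOn (b : BundleChart.{u} Fib) (A : Set X) (s : ∀ x, Fib x) : Prop :=
  ∃ f : b.amb.lvl 0 → b.F.lvl 1,
    (∀ q ∈ b.base.pull A, b.F.incl 0 (f q) =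
      (b.Φ ⟨b.base.φ.symm (b.base.S.ret q), s (b.base.φ.symm (b.base.S.ret q))⟩).2) ∧
    IsScSmooth (E := b.amb) (F := b.F.shift) (b.base.pull A) f

theorem IsScPlusOn.mono {A B : Set X} {s : ∀ x, Fib x} (h : b.IsScPlusOn A s) (hBA : B ⊆ A) :
    b.IsScPlusOn B s := by
  obtain ⟨f, h1, h2⟩ := h
  have h3 := b.base.pull_mono (A := B) (B := A) fun _ hx => hBA hx.1
  exact ⟨f, fun q hq => h1 q (h3 hq), h2.mono h3⟩

theorem IsScPlusOn.of_locally {A : Set X} (hA : IsOpen A) {s : ∀ x, Fib x}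
    (h : ∀ x ∈ A, x ∈ b.base.φ.source → ∃ A', IsOpen A' ∧ x ∈ A' ∧ b.IsScPlusOn (A ∩ A') s) :
    b.IsScPlusOn A s := by
  have hex : ∀ q, ∃ y : b.F.lvl 1, q ∈ b.base.pull A → b.F.incl 0 y =
      (b.Φ ⟨b.base.φ.symm (b.base.S.ret q), s (b.base.φ.symm (b.base.S.ret q))⟩).2 := by
    intro q
    by_cases hq : q ∈ b.base.pull A
    · obtain ⟨A', -, hxA', f, hf, -⟩ := h _ hq.2.2 (b.base.φ.map_target hq.2.1)
      exact ⟨f q, fun _ => hf q ⟨hq.1, hq.2.1, hq.2.2, hxA'⟩⟩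
    · exact ⟨0, fun h => absurd h hq⟩
  choose f hf using hex
  refine ⟨f, hf, MPChart.isScSmooth_pull_of_locally hA fun x hx hxb => ?_⟩
  obtain ⟨A', hA', hxA', f', hf', hf''⟩ := h x hx hxb
  refine ⟨A', hA', hxA', hf''.congr fun q hq => b.F.incl_injective 0 ?_⟩
  rw [hf' q hq, hf q (b.base.pull_mono (fun _ hx => hx.1.1) hq)]

/-- A strong bundle map, covering an inverse of `τ`, takes sc⁺-sections to sc⁺-sections. -/
theorem IsScPlusOn.transfer {A B : Set X} (hB : IsOpen B) {s s' : ∀ x, Fib x} {τ : X → X}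
    {M : Tot Fib → Tot Fib} (hs : b.IsScPlusOn B s)
    (hτ : IsScSmooth (b'.base.pull A) (b'.base.rep b.base τ)) (hM : b.StrongSmooth b' B M)
    (h : ∀ x ∈ A, x ∈ b'.base.φ.source → τ x ∈ B ∧ τ x ∈ b.base.φ.source ∧
      M ⟨τ x, s (τ x)⟩ = ⟨x, s' x⟩) : b'.IsScPlusOn A s' := by
  obtain ⟨f, hf, hfs⟩ := hs
  obtain ⟨-, M₁, hM₁, hM₁s⟩ := hM
  let r := b'.base.rep b.base τ
  have h' : ∀ q ∈ b'.base.pull A, _ := fun q hq => h _ hq.2.2 (b'.base.φ.map_target hq.2.1)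
  have hr : ∀ q ∈ b'.base.pull A, r q ∈ b.base.pull B := fun q hq =>
    b.base.apply_mem_pull (h' q hq).2.1 (h' q hq).1
  refine ⟨fun q => (M₁ (r q, f (r q))).2, fun q hq => ?_, ?_⟩
  · have hsrc := mem_source (h' q hq).2.1 (s (τ (b'.base.φ.symm (b'.base.S.ret q))))
    have e1 : b.base.φ.symm (b.base.S.ret (r q)) = τ (b'.base.φ.symm (b'.base.S.ret q)) :=
      b.base.symm_ret_apply (h' q hq).2.1
    have e2 : b.F.incl 0 (f (r q)) = (b.Φ ⟨τ (b'.base.φ.symm (b'.base.S.ret q)),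
        s (τ (b'.base.φ.symm (b'.base.S.ret q)))⟩).2 := by
      rw [hf _ (hr q hq), e1]
    have e3 : (r q, b.F.incl 0 (f (r q))) = b.Φ ⟨τ (b'.base.φ.symm (b'.base.S.ret q)),
        s (τ (b'.base.φ.symm (b'.base.S.ret q)))⟩ :=
      Prod.ext (b.covers _ hsrc).symm e2
    have e4 := congrArg Prod.snd (hM₁ (r q, f (r q)) (hr q hq))
    refine e4.trans ?_
    show (b'.Φ (M (b.Φ.symm (b.ret (r q, b.F.incl 0 (f (r q))))))).2 = _
    rw [e3, ret_apply hsrc, b.Φ.left_inv hsrc, (h' q hq).2.2]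
  · have h1 : IsScSmooth (E := b'.amb) (F := b.amb.prod b.F.shift) (b'.base.pull A)
        (fun q => (r q, f (r q))) :=
      hτ.prodMk (hfs.comp hτ (b.base.isScDomain_pull hB) hr)
    have h2 := hM₁s.comp h1 ((b.base.isScDomain_pull hB).prod_univ (F := b.F.shift)) hr
    exact (isScSmooth_snd (E := b'.amb) (F := b'.F.shift) (U := Set.univ)).comp h2 .univ
      fun _ _ => trivial

/-- Strong bundle maps preserve fiber regularity one. -/
theorem StrongSmooth.snd_mem_range {B : Set X} {M : Tot Fib → Tot Fib} (hM : b.StrongSmooth b' B M)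
    {e : Tot Fib} (he : e ∈ b.Φ.source) (heB : e.proj ∈ B)
    (h : (b.Φ e).2 ∈ Set.range (b.F.incl 0)) : (b'.Φ (M e)).2 ∈ Set.range (b'.F.incl 0) := by
  obtain ⟨-, M₁, hM₁, -⟩ := hM
  obtain ⟨a, ha⟩ := h
  have h1 : (b.Φ e).1 ∈ b.base.pull B := by
    rw [b.covers e he]; exact b.base.apply_mem_pull (proj_mem_source he) heB
  have e3 : ((b.Φ e).1, b.F.incl 0 a) = b.Φ e := Prod.ext rfl ha
  refine ⟨_, (congrArg Prod.snd (hM₁ ((b.Φ e).1, a) h1)).trans ?_⟩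
  show (b'.Φ (M (b.Φ.symm (b.ret ((b.Φ e).1, b.F.incl 0 a))))).2 = _
  rw [e3, ret_apply he, b.Φ.left_inv he]

theorem snd_zero {x : X} (hx : x ∈ b.base.φ.source) : (b.Φ ⟨x, 0⟩).2 = 0 :=
  (b.linear x hx).map_zero

theorem isScPlusOn_zero (A : Set X) : b.IsScPlusOn A (fun _ => 0) := by
  refine ⟨fun _ => 0, fun q hq => ?_, fun n => ?_⟩
  · rw [snd_zero (b.base.φ.map_target hq.2.1), map_zero]
  · exact IsSc.const (F := b.F.shift) (fun _ => 0) fun m => map_zero (b.F.incl (m + 1))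

/-! ### Local sections through smooth points -/

theorem exists_snd_eq (b : BundleChart.{u} Fib) (u₀ : b.F.lvl 0) (x : X) :
    ∃ a : Fib x, x ∈ b.base.φ.source → (b.Φ ⟨x, a⟩).2 = b.R.ρ (b.base.φ x) u₀ := by
  by_cases hx : x ∈ b.base.φ.source
  · have h1 : (b.base.φ x, b.R.ρ (b.base.φ x) u₀) ∈ b.Φ.target := by
      rw [b.target_eq]
      exact ⟨b.base.φ.map_source hx, b.R.idem _ (b.base.φ.map_source hx) _⟩
    have h2 := b.Φ.map_target h1
    have h3 := b.Φ.right_inv h1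
    have h4 := b.covers _ h2
    generalize b.Φ.symm (b.base.φ x, b.R.ρ (b.base.φ x) u₀) = e' at h2 h3 h4
    obtain ⟨y, a⟩ := e'
    rw [h3] at h4
    obtain rfl : x = y := b.base.φ.injOn hx (proj_mem_source h2) h4
    exact ⟨a, fun _ => congrArg Prod.snd h3⟩
  · exact ⟨0, fun h => absurd h hx⟩

/-- The section over the domain of the chart `b` obtained by projecting the constant section `u₀` of
the model to the core of the strong bundle splicing. It is arbitrary outside that domain. -/
noncomputable def modelSection (b : BundleChart.{u} Fib) (u₀ : b.F.lvl 0) (x : X) : Fib x :=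
  (b.exists_snd_eq u₀ x).choose

theorem snd_modelSection (u₀ : b.F.lvl 0) {x : X} (hx : x ∈ b.base.φ.source) :
    (b.Φ ⟨x, b.modelSection u₀ x⟩).2 = b.R.ρ (b.base.φ x) u₀ :=
  (b.exists_snd_eq u₀ x).choose_spec hx

theorem modelSection_eq {e : Tot Fib} (he : e ∈ b.Φ.source) :
    b.modelSection (b.Φ e).2 e.proj = e.snd := by
  have hx := proj_mem_source he
  have h1 := b.Φ.map_source he
  rw [b.target_eq] at h1
  have h2 : b.Φ ⟨e.proj, b.modelSection (b.Φ e).2 e.proj⟩ = b.Φ e := by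
    refine Prod.ext ?_ ?_
    · rw [b.covers _ (mem_source hx _), b.covers _ he]
    · rw [snd_modelSection _ hx, ← b.covers _ he]; exact h1.2
  have h3 := b.Φ.injOn (mem_source hx _) he h2
  obtain ⟨x, a⟩ := e
  injection h3 with h4 h5

/-- If `u` is a smooth vector, its projections to the core lie on level one and depend sc-smoothly
on the base point as elements of `F¹`: this is the strong part of the bundle splicing. -/
theorem exists_isScSmooth_modelSection (u : ∀ m, b.F.lvl m)
    (hu : ∀ m, b.F.incl m (u (m + 1)) = u m) :
    ∃ f : b.amb.lvl 0 → b.F.lvl 1,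
      (∀ p ∈ b.base.φ.target, b.F.incl 0 (f p) = b.R.ρ p (u 0)) ∧
      IsScSmooth (E := b.amb) (F := b.F.shift) (b.base.pull Set.univ)
        (fun q => f (b.base.S.ret q)) := by
  obtain ⟨ρ₁, h1, h2⟩ := b.R.strong
  refine ⟨fun p => ρ₁ p (u 1), fun p hp => by rw [h1 p hp, hu 0], ?_⟩
  have h3 : IsScSmooth (E := b.amb) (F := b.amb.prod b.F.shift) (b.base.pull Set.univ)
      (fun q => (q, u 1)) :=
    isScSmooth_id.prodMk fun n => IsSc.const (F := b.F.shift) (fun m => u (m + 1))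
      fun m => hu (m + 1)
  refine h2.comp h3 ?_ fun q hq => ⟨hq.1, hq.2.1⟩
  have h4 : {q : b.amb.lvl 0 × b.F.lvl 1 |
        q.1.1 ∈ b.base.S.V ∧ b.base.S.ret q.1 ∈ b.base.φ.target} =
      {q : b.amb.lvl 0 × b.F.lvl 1 | q.1 ∈ b.base.pull Set.univ} :=
    Set.ext fun q => ⟨fun hq => ⟨hq.1, hq.2, trivial⟩, fun hq => ⟨hq.1, hq.2.1⟩⟩
  exact h4 ▸ (b.base.isScDomain_pull isOpen_univ).prod_univ (F := b.F.shift)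

theorem isScPlusOn_smul_modelSection (u : ∀ m, b.F.lvl m)
    (hu : ∀ m, b.F.incl m (u (m + 1)) = u m) {β : b.amb.lvl 0 → ℝ} (hβ : ContDiff ℝ ∞ β) :
    b.IsScPlusOn Set.univ (fun x => β (b.base.φ x) • b.modelSection (u 0) x) := by
  obtain ⟨f, hf, hfs⟩ := exists_isScSmooth_modelSection u hu
  refine ⟨fun q => β (b.base.S.ret q) • f (b.base.S.ret q), fun q hq => ?_, ?_⟩
  · have hx := b.base.φ.map_target hq.2.1
    rw [(b.linear _ hx).map_smul, snd_modelSection _ hx, b.base.φ.right_inv hq.2.1, map_smul,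
      hf _ hq.2.1]
  · have h1 : IsScSmooth (E := b.amb.prod b.F.shift) (F := b.F.shift) Set.univ
        (fun p => β p.1 • p.2) := fun n =>
      IsSc.contDiff_smul (E := b.amb.prod b.F.shift) (F := b.F.shift)
        (hβ.comp contDiff_fst) .univ (isScSmooth_snd n)
    exact h1.comp ((b.base.S.isScSmooth_ret.mono fun _ hq => hq.1).prodMk hfs) .univ
      fun _ _ => trivial

/-- Near every point of a chart modelled on sc-Hilbert spaces there is a cutoff function supported
in a given neighborhood, because the square of a Hilbert norm on level zero is smooth. -/
theorem exists_cutoff (b : BundleChart.{u} Fib) [RegularSpace X]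
    (hW : b.base.S.W.IsSeparableHilbert) (hE : b.base.S.E.IsSeparableHilbert) {x : X}
    (hx : x ∈ b.base.φ.source) {D : Set X} (hD : D ∈ 𝓝 x) :
    ∃ (β : b.amb.lvl 0 → ℝ) (A : Set X), ContDiff ℝ ∞ β ∧ (∀ p, 0 ≤ β p) ∧ (∀ p, β p ≤ 1) ∧
      β (b.base.φ x) = 1 ∧ IsClosed A ∧ A ⊆ D ∧
      ∀ y ∈ b.base.φ.source, β (b.base.φ y) ≠ 0 → y ∈ A := by
  obtain ⟨A, hA, hAc, hAD⟩ := exists_mem_nhds_isClosed_subset hD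
  obtain ⟨-, H₁, _, _, ⟨T₁⟩⟩ := hW 0
  obtain ⟨-, H₂, _, _, ⟨T₂⟩⟩ := hE 0
  have h1 := b.base.cont_symm _ (b.base.φ.map_source hx)
  have h2 : A ∈ 𝓝 (b.base.φ.symm (b.base.φ x)) := by rwa [b.base.φ.left_inv hx]
  obtain ⟨O, hO, hOA⟩ := mem_nhdsWithin_iff_exists_mem_nhds_inter.1 (h1 h2)
  let T : b.amb.lvl 0 ≃L[ℝ] H₁ × H₂ := T₁.prodCongr T₂
  have h3 : T.symm ⁻¹' O ∈ 𝓝 (T (b.base.φ x)) :=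
    T.symm.continuous.continuousAt (by simpa using hO)
  obtain ⟨r, hr, hball⟩ := Metric.mem_nhds_iff.1 h3
  let β₁ : ContDiffBump (T (b.base.φ x)).1 := ⟨r / 2, r, half_pos hr, half_lt_self hr⟩
  let β₂ : ContDiffBump (T (b.base.φ x)).2 := ⟨r / 2, r, half_pos hr, half_lt_self hr⟩
  refine ⟨fun p => β₁ (T p).1 * β₂ (T p).2, A, ?_, fun p => mul_nonneg β₁.nonneg β₂.nonneg,
    fun p => mul_le_one₀ β₁.le_one β₂.nonneg β₂.le_one, ?_, hAc, hAD, fun y hy hne => ?_⟩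
  · exact (β₁.contDiff.comp (contDiff_fst.comp T.contDiff)).mul
      (β₂.contDiff.comp (contDiff_snd.comp T.contDiff))
  · show β₁ (T (b.base.φ x)).1 * β₂ (T (b.base.φ x)).2 = 1
    rw [β₁.one_of_mem_closedBall (Metric.mem_closedBall_self (half_pos hr).le),
      β₂.one_of_mem_closedBall (Metric.mem_closedBall_self (half_pos hr).le), one_mul]
  · have h4 : (T (b.base.φ y)).1 ∈ Metric.ball (T (b.base.φ x)).1 r :=
      β₁.support_eq ▸ left_ne_zero_of_mul hne
    have h5 : (T (b.base.φ y)).2 ∈ Metric.ball (T (b.base.φ x)).2 r :=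
      β₂.support_eq ▸ right_ne_zero_of_mul hne
    have h6 : T (b.base.φ y) ∈ Metric.ball (T (b.base.φ x)) r := by
      rw [Metric.mem_ball, Prod.dist_eq]; exact max_lt h4 h5
    have h7 : b.base.φ y ∈ O := by simpa using hball h6
    have h8 := hOA ⟨h7, b.base.φ.map_source hy⟩
    rwa [Set.mem_preimage, b.base.φ.left_inv hy] at h8

end BundleChart

namespace StrongBundle

variable {X : Type v} [TopologicalSpace X] [Groupoid.{w} X] [TopologicalSpace (Mor X)]
  {G : EpGroupoid.{u} X} {Fib : X → Type z} [∀ x, AddCommGroup (Fib x)] [∀ x, Module ℝ (Fib x)]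
  [TopologicalSpace (Tot Fib)] (P : StrongBundle G Fib)

/-! ### The action of the morphisms -/

theorem μ_inv_μ {x y : X} (g : x ⟶ y) (e : Fib x) : P.μ (Groupoid.inv g) (P.μ g e) = e := by
  rw [← P.μ_comp, Groupoid.comp_inv, P.μ_id]

theorem μ_μ_inv {x y : X} (g : x ⟶ y) (e : Fib y) : P.μ g (P.μ (Groupoid.inv g) e) = e := by
  rw [← P.μ_comp, Groupoid.inv_comp, P.μ_id]

theorem μ_inv_eq_iff {x y : X} (g : x ⟶ y) (e : Fib x) (e' : Fib y) :
    P.μ (Groupoid.inv g) e' = e ↔ P.μ g e = e' :=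
  ⟨fun h => h ▸ P.μ_μ_inv g e', fun h => h ▸ P.μ_inv_μ g e⟩

theorem μ_eq_zero_iff {x y : X} (g : x ⟶ y) (e : Fib x) : P.μ g e = 0 ↔ e = 0 := by
  rw [← P.μ_inv_eq_iff, map_zero, eq_comm]

variable {P}

theorem μ_mem_E01 {x y : X} (g : x ⟶ y) {e : Fib x} (he : (⟨x, e⟩ : Tot Fib) ∈ P.E01) :
    (⟨y, P.μ g e⟩ : Tot Fib) ∈ P.E01 := by
  obtain ⟨b, hb, heb, hr⟩ := he
  obtain ⟨b', hb', hy⟩ := P.cover y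
  obtain ⟨a, a', V, V', hbis, -, -⟩ := G.exists_isBisection ⟨x, y, g⟩ univ_mem univ_mem
  have hax : a x = ⟨y, g⟩ := Mor.mk_inj hbis.apply_src
  have h1 := (P.μ_smooth V a hbis.isOpen hbis.smooth b hb b' hb').snd_mem_range heb
    ⟨hbis.mem, by rw [Set.mem_ofPred_eq, hax]; exact hy⟩ hr
  simp only at h1
  rw [hax] at h1
  exact ⟨b', hb', BundleChart.mem_source hy _, h1⟩

theorem zero_mem_E01 (x : X) : (⟨x, 0⟩ : Tot Fib) ∈ P.E01 := by
  obtain ⟨b, hb, hx⟩ := P.cover x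
  exact ⟨b, hb, BundleChart.mem_source hx _, 0, by rw [BundleChart.snd_zero hx, map_zero]⟩

/-- The pull-back of an sc⁺-section along a bisection is an sc⁺-section. -/
theorem isScPlusSectionOn_pullback {m : Mor X} {a a' : SrcSection X} {V V' : Set X}
    (h : G.IsBisection m a a' V V') {b : BundleChart.{u} Fib} (hb : b ∈ P.atlas)
    {s : ∀ x, Fib x} (hs : b.IsScPlusOn Set.univ s) (hV' : V' ⊆ b.base.φ.source) :
    P.IsScPlusSectionOn V (fun y => P.μ (Groupoid.inv (a y).2) (s (a y).1)) := by
  intro b' hb'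
  have hτ := h.smooth_tgt.isScSmooth_rep h.isOpen (P.base_compat b' hb') (P.base_compat b hb)
  have hopen : IsOpen (V' ∩ {w | (a' w).1 ∈ b'.base.φ.source}) :=
    (G.continuous_tgt.comp_continuousOn h.smooth'.1).isOpen_inter_preimage h.isOpen'
      b'.base.open_source
  refine BundleChart.IsScPlusOn.transfer (b' := b')
    (s' := fun y => P.μ (Groupoid.inv (a y).2) (s (a y).1)) hopen (hs.mono (Set.subset_univ _))
    (hτ.mono (b'.base.pull_mono fun y hy => ⟨hy.1, hV' (h.mapsTo y hy.1)⟩))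
    (P.μ_smooth V' a' h.isOpen' h.smooth' b hb b' hb') fun y hy hyb' => ?_
  refine ⟨⟨h.mapsTo y hy, ?_⟩, hV' (h.mapsTo y hy), ?_⟩
  · rw [Set.mem_ofPred_eq, h.apply_apply y hy]; exact hyb'
  · show (⟨(a' (a y).1).1, P.μ (a' (a y).1).2 (s (a y).1)⟩ : Tot Fib) = _
    rw [h.apply_apply y hy]

/-! ### Averaging a section over the arrows into a neighborhood -/

/-- The arrows from `y` to points of `U`. -/
abbrev OutInto {X : Type v} [Groupoid.{w} X] (U : Set X) (y : X) : Type (max v w) :=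
  {m : Σ y' : X, (y ⟶ y') // m.1 ∈ U}

/-- Isomorphic objects have the same arrows into `U`. -/
def outIntoEquiv {X : Type v} [Groupoid.{w} X] (U : Set X) {x y : X} (g : x ⟶ y) :
    OutInto U y ≃ OutInto U x where
  toFun m := ⟨⟨m.1.1, g ≫ m.1.2⟩, m.2⟩
  invFun m := ⟨⟨m.1.1, Groupoid.inv g ≫ m.1.2⟩, m.2⟩
  left_inv m := by simp [← Category.assoc]
  right_inv m := by simp [← Category.assoc]

/-- The number of arrows into a neighborhood with a natural representation is the order of the
isotropy group, over all points where there are any. -/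
theorem _root_.Polyfold.EpGroupoid.HasNaturalRep.nonempty_equiv {x : X} {U : Set X}
    (h : G.HasNaturalRep x U) {y : X} (hy : Nonempty (OutInto U y)) :
    Nonempty ((x ⟶ x) ≃ OutInto U y) := by
  obtain ⟨-, -, Γ, -, -, hΓ, -, -, -, hex⟩ := h
  have key : ∀ y ∈ U, Nonempty ((x ⟶ x) ≃ OutInto U y) := fun y hy =>
    ⟨Equiv.ofBijective (fun g => ⟨Γ g y, hΓ g y hy⟩) ⟨fun g g' hg =>
      (hex y hy _ (hΓ g y hy) (Γ g y).2).unique rfl (congrArg Subtype.val hg).symm,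
      fun m => let ⟨g, hg, _⟩ := hex y hy m.1.1 m.2 m.1.2; ⟨g, Subtype.ext hg⟩⟩⟩
  obtain ⟨m⟩ := hy
  obtain ⟨E⟩ := key _ m.2
  exact ⟨E.trans (outIntoEquiv U m.1.2)⟩

theorem _root_.Polyfold.EpGroupoid.HasNaturalRep.finite_outInto {x : X} {U : Set X}
    (h : G.HasNaturalRep x U) (y : X) : Finite (OutInto U y) := by
  have := G.finite_isotropy x
  by_cases hy : Nonempty (OutInto U y)
  · obtain ⟨E⟩ := h.nonempty_equiv hy
    exact Finite.of_equiv _ E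
  · rw [not_nonempty_iff] at hy; infer_instance

variable (P)

open Classical in
/-- The functor counting, for a vector `e` over `y`, the proportion of those arrows from `y` into
`U` that take `e` to a value of the section `s`. Over the points without arrows into `U` it is the
characteristic function of the zero section. -/
noncomputable def average (U : Set X) (s : ∀ x, Fib x) (e : Tot Fib) : ℚ≥0 :=
  if Nonempty (OutInto U e.proj) then
    Nat.card {m : OutInto U e.proj // P.μ m.1.2 e.snd = s m.1.1} / Nat.card (OutInto U e.proj)
  else if e.snd = 0 then 1 else 0

theorem average_μ (U : Set X) (s : ∀ x, Fib x) {x y : X} (g : x ⟶ y) (e : Fib x) :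
    P.average U s ⟨y, P.μ g e⟩ = P.average U s ⟨x, e⟩ := by
  have h1 := (outIntoEquiv U g).nonempty_congr
  have h2 := Nat.card_congr (outIntoEquiv U g)
  have h3 : Nat.card {m : OutInto U y // P.μ m.1.2 (P.μ g e) = s m.1.1} =
      Nat.card {m : OutInto U x // P.μ m.1.2 e = s m.1.1} :=
    Nat.card_congr ((outIntoEquiv U g).subtypeEquiv fun m => by
      show _ ↔ P.μ (g ≫ m.1.2) e = _
      rw [P.μ_comp]; rfl)
  by_cases hx : Nonempty (OutInto U x)
  · simp only [average, hx, h1.2 hx, if_true, h2, h3]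
  · simp only [average, hx, mt h1.1 hx, if_false]
    by_cases he : e = 0
    · rw [if_pos he, if_pos ((P.μ_eq_zero_iff g e).2 he)]
    · rw [if_neg he, if_neg (mt (P.μ_eq_zero_iff g e).1 he)]

open Classical in
theorem average_of_forall_eq_zero {U : Set X} {s : ∀ x, Fib x} {y : X} [Finite (OutInto U y)]
    (h : ∀ m : OutInto U y, s m.1.1 = 0) (e : Fib y) :
    P.average U s ⟨y, e⟩ = if e = 0 then 1 else 0 := by
  by_cases hne : Nonempty (OutInto U y)
  · have h0 : (Nat.card (OutInto U y) : ℚ≥0) ≠ 0 := Nat.cast_ne_zero.2 Nat.card_pos.ne'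
    simp only [average, hne, if_true, h, P.μ_eq_zero_iff]
    by_cases he : e = 0
    · rw [if_pos he, Nat.card_congr (Equiv.subtypeUnivEquiv fun _ => he), div_self h0]
    · have : IsEmpty {m : OutInto U y // e = 0} := ⟨fun m => he m.2⟩
      rw [if_neg he, Nat.card_of_isEmpty, Nat.cast_zero, zero_div]
  · simp only [average, hne, if_false]

theorem exists_of_average_pos {U : Set X} {s : ∀ x, Fib x} {y : X} {e : Fib y}
    (h : 0 < P.average U s ⟨y, e⟩) :
    (∃ m : OutInto U y, P.μ m.1.2 e = s m.1.1) ∨ e = 0 := by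
  by_cases hne : Nonempty (OutInto U y)
  · simp only [average, hne, if_true] at h
    left
    by_contra! hcon
    have : IsEmpty {m : OutInto U y // P.μ m.1.2 e = s m.1.1} := ⟨fun m => hcon m.1 m.2⟩
    rw [Nat.card_of_isEmpty, Nat.cast_zero, zero_div] at h
    exact lt_irrefl _ h
  · right
    by_contra hcon
    simp [average, hne, hcon] at h

theorem average_pos {U : Set X} {s : ∀ x, Fib x} {y : X} [Finite (OutInto U y)] (hy : y ∈ U) :
    0 < P.average U s ⟨y, s y⟩ := by
  have hne : Nonempty (OutInto U y) := ⟨⟨⟨y, 𝟙 y⟩, hy⟩⟩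
  have : Nonempty {m : OutInto U y // P.μ m.1.2 (s y) = s m.1.1} :=
    ⟨⟨⟨⟨y, 𝟙 y⟩, hy⟩, P.μ_id y (s y)⟩⟩
  simp only [average, hne, if_true]
  exact div_pos (Nat.cast_pos.2 Nat.card_pos) (Nat.cast_pos.2 Nat.card_pos)

variable {P}

/-- Over a neighborhood with a natural representation, the average of an sc⁺-section supported in a
closed set with closed saturation is an sc⁺-multisection. Near a point with arrows into `U`, these
arrows extend to sections of the source map that exhaust all arrows into `U`, since the number of
such arrows is constant; the pull-backs of `s` along them are the local sections. -/
theorem isScPlusMultisection_average {x : X} {U A : Set X} (hU : G.HasNaturalRep x U)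
    {b : BundleChart.{u} Fib} (hb : b ∈ P.atlas) (hUb : U ⊆ b.base.φ.source) {s : ∀ x, Fib x}
    (hs : b.IsScPlusOn Set.univ s) (hAU : A ⊆ U) (hsA : ∀ y ∈ U, y ∉ A → s y = 0)
    (hA : IsClosed {y : X | ∃ y' ∈ A, Nonempty (y ⟶ y')}) :
    P.IsScPlusMultisection (P.average U s) := by
  classical
  have := G.mor.t2
  have hfin := fun y => hU.finite_outInto y
  refine ⟨fun g e => P.average_μ U s g e, fun z => ?_⟩
  by_cases hz : z ∈ {y : X | ∃ y' ∈ A, Nonempty (y ⟶ y')}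
  · obtain ⟨z', hz', ⟨k⟩⟩ := hz
    have hne : Nonempty (OutInto U z) := ⟨⟨⟨z', k⟩, hAU hz'⟩⟩
    choose a a' V V' hbis _ hV' using fun j : OutInto U z =>
      G.exists_isBisection ⟨z, j.1.1, j.1.2⟩ univ_mem (hU.1.mem_nhds j.2)
    have hdom : ∀ᶠ y in 𝓝 z, ∀ j, y ∈ V j :=
      eventually_all.2 fun j => (hbis j).isOpen.mem_nhds (hbis j).mem
    have hcont : ∀ j, ContinuousAt (a j).toMor z := fun j =>
      (hbis j).smooth.1.continuousAt ((hbis j).isOpen.mem_nhds (hbis j).mem)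
    have hinj : ∀ᶠ y in 𝓝 z, ∀ j j', j ≠ j' → (a j).toMor y ≠ (a j').toMor y := by
      refine eventually_all.2 fun j => eventually_all.2 fun j' => ?_
      by_cases h : j = j'
      · exact Eventually.of_forall fun y h' => absurd h h'
      have h1 : (a j).toMor z ≠ (a j').toMor z := by
        rw [(hbis j).apply_src, (hbis j').apply_src]
        exact fun h2 => h (Subtype.ext (Mor.mk_inj h2))
      exact (((hcont j).prodMk (hcont j')).eventually
        (isClosed_diagonal.isOpen_compl.eventually_mem h1)).mono fun y hy _ => hy
    obtain ⟨W, hWsub, hW⟩ := G.exists_hasNaturalRep z (hdom.and hinj)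
    have hcardz : 0 < Nat.card (OutInto U z) := Nat.card_pos
    let E := (Finite.equivFin (OutInto U z)).symm
    refine ⟨W, hW, Nat.card (OutInto U z),
      fun i y => P.μ (Groupoid.inv (a (E i) y).2) (s (a (E i) y).1),
      fun _ => (Nat.card (OutInto U z) : ℚ≥0)⁻¹, fun i => ?_, fun _ => ?_, ?_, fun y hy e => ?_⟩
    · intro b' hb'
      exact BundleChart.IsScPlusOn.mono (b := b')
        (s := fun y => P.μ (Groupoid.inv (a (E i) y).2) (s (a (E i) y).1))
        (A := V (E i))
        (isScPlusSectionOn_pullback (hbis (E i)) hb hs ((hV' _).trans hUb) b' hb')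
        fun y hy => (hWsub hy).1 _
    · exact inv_pos.2 (Nat.cast_pos.2 hcardz)
    · rw [Finset.sum_const, Finset.card_univ, Fintype.card_fin, nsmul_eq_mul,
        mul_inv_cancel₀ (Nat.cast_ne_zero.2 hcardz.ne')]
    · -- Evaluating the sections at `y` gives as many arrows into `U` as there are in total.
      let ι : OutInto U z → OutInto U y := fun j =>
        ⟨a j y, hV' j ((hbis j).mapsTo y ((hWsub hy).1 j))⟩
      have hney : Nonempty (OutInto U y) := hne.map ι
      obtain ⟨E₁⟩ := hU.nonempty_equiv hne
      obtain ⟨E₂⟩ := hU.nonempty_equiv hney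
      have hcard : Nat.card (OutInto U y) = Nat.card (OutInto U z) :=
        Nat.card_congr (E₂.symm.trans E₁)
      have hι : Function.Injective ι := fun j j' h => by
        by_contra hne
        refine (hWsub hy).2 j j' hne ?_
        have h' : a j y = a j' y := congrArg Subtype.val h
        rw [SrcSection.toMor, SrcSection.toMor, h']
      have hbij : Function.Bijective ι := by
        refine (Nat.bijective_iff_injective_and_card ι).2 ⟨hι, hcard.symm⟩
      have h1 : Nat.card {m : OutInto U y // P.μ m.1.2 e = s m.1.1} =
          (Finset.univ.filter fun i =>
            P.μ (Groupoid.inv (a (E i) y).2) (s (a (E i) y).1) = e).card := by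
        rw [← Fintype.card_subtype, ← Nat.card_eq_fintype_card]
        refine (Nat.card_congr
          (Equiv.subtypeEquiv (E.trans (Equiv.ofBijective ι hbij)) fun i => ?_)).symm
        exact P.μ_inv_eq_iff _ _ _
      rw [Finset.sum_const, nsmul_eq_mul, ← div_eq_mul_inv]
      simp only [average, hney, if_true, h1, hcard]
  · obtain ⟨W, hWsub, hW⟩ := G.exists_hasNaturalRep z (hA.isOpen_compl.mem_nhds hz)
    refine ⟨W, hW, 1, fun _ _ => 0, fun _ => 1, fun _ b' _ => b'.isScPlusOn_zero W,
      fun _ => one_pos, by simp, fun y hy e => ?_⟩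
    rw [P.average_of_forall_eq_zero (fun m => hsA _ m.2 fun hm => hWsub hy ⟨_, hm, ⟨m.1.2⟩⟩)]
    by_cases he : e = 0
    · simp [he]
    · simp [he, Ne.symm he]

/-- An auxiliary norm is continuous along the model section of a smooth vector, since this section
is continuous into level one. -/
theorem IsAuxiliaryNorm.continuousOn_modelSection {N : Tot Fib → ℝ≥0} (hN : P.IsAuxiliaryNorm N)
    {b : BundleChart.{u} Fib} (hb : b ∈ P.atlas) (u : ∀ m, b.F.lvl m)
    (hu : ∀ m, b.F.incl m (u (m + 1)) = u m) :
    ContinuousOn (fun x => N ⟨x, b.modelSection (u 0) x⟩) b.base.φ.source := by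
  obtain ⟨f, hf, hfs⟩ := BundleChart.exists_isScSmooth_modelSection u hu
  have h1 : ContinuousOn (fun x => f (b.base.S.ret (b.base.φ x))) b.base.φ.source :=
    hfs.continuousOn.comp b.base.cont fun x hx => b.base.apply_mem_pull hx trivial
  have h2 : ∀ x ∈ b.base.φ.source, b.Φ ⟨x, b.modelSection (u 0) x⟩ =
      (b.base.φ x, b.F.incl 0 (f (b.base.S.ret (b.base.φ x)))) := fun x hx => by
    have h3 := b.base.φ.map_source hx
    rw [b.base.S.ret_eq_self (b.base.target_subset_core h3), hf _ h3]
    exact Prod.ext (b.covers _ (BundleChart.mem_source hx _)) (BundleChart.snd_modelSection _ hx)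
  refine ((hN.continuous b hb).comp (b.base.cont.prodMk h1) fun x hx => ?_).congr fun x hx => ?_
  · show (b.base.φ x, b.F.incl 0 (f (b.base.S.ret (b.base.φ x)))) ∈ b.Φ.target
    rw [← h2 x hx]; exact b.Φ.map_source (BundleChart.mem_source hx _)
  · show _ = N (b.Φ.symm (b.base.φ x, b.F.incl 0 (f (b.base.S.ret (b.base.φ x)))))
    rw [← h2 x hx, b.Φ.left_inv (BundleChart.mem_source hx _)]

/-- The fiber component of a smooth point is a coherent sequence. -/
theorem IsSmoothPoint.exists_levels {e : Tot Fib} (he : P.IsSmoothPoint e) :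
    ∃ b ∈ P.atlas, e ∈ b.Φ.source ∧ ∃ u : ∀ m, b.F.lvl m,
      (∀ m, b.F.incl m (u (m + 1)) = u m) ∧ u 0 = (b.Φ e).2 := by
  obtain ⟨b, hb, heb, h⟩ := he
  choose p hp using h
  have h1 : ∀ m, b.F.emb m (p m).2 = (b.Φ e).2 := fun m =>
    (congrArg Prod.snd (ScBanach.prod_emb b.amb b.F m (p m))).symm.trans (congrArg Prod.snd (hp m))
  exact ⟨b, hb, heb, fun m => (p m).2,
    fun m => b.F.emb_injective m ((h1 (m + 1)).trans (h1 m).symm), h1 0⟩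

end StrongBundle

end

end Polyfold

theorem mainTheorem8 {X : Type v} [TopologicalSpace X] [CategoryTheory.Groupoid.{w} X]
    [TopologicalSpace (Polyfold.Mor X)] (G : Polyfold.EpGroupoid.{u} X)
    {Fib : X → Type z} [∀ x, AddCommGroup (Fib x)] [∀ x, Module ℝ (Fib x)]
    [TopologicalSpace (Polyfold.Tot Fib)] (P : Polyfold.StrongBundle G Fib)
    (hG : G.ob.IsSeparableHilbert) (hP : P.IsSeparableHilbert)
    (N : Polyfold.Tot Fib → ℝ≥0) (hN : P.IsAuxiliaryNorm N)
    (e : Polyfold.Tot Fib) (he : P.IsSmoothPoint e)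
    (U : Set X) (hU : IsOpen U) (hsat : Polyfold.IsSaturated U) (heU : e.proj ∈ U) (ε : ℝ) :
    ∃ Λ : Polyfold.Tot Fib → ℚ≥0,
      P.IsScPlusMultisection Λ ∧ Polyfold.multisectionSupport Λ ⊆ U ∧ 0 < Λ e ∧
      ((N e : ℝ) < ε → ∀ h : Polyfold.Tot Fib, 0 < Λ h → h ∈ P.E01 ∧ (N h : ℝ) < ε) := by
  open Polyfold StrongBundle in
  have := G.ob.t2
  have := G.ob.paracompact
  obtain ⟨b, hb, heb, u, hu, hu0⟩ := he.exists_levels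
  have hxb := BundleChart.proj_mem_source heb
  obtain ⟨V, hV, hxV, hclosed⟩ := G.exists_isClosed_saturation e.proj
  have hmodel : b.modelSection (u 0) e.proj = e.snd := hu0 ▸ BundleChart.modelSection_eq heb
  -- The neighborhood is taken so small that the norm of the section stays below `ε` if it is so at
  -- `e`; there is no condition otherwise.
  have hNe : ∀ᶠ x in 𝓝 e.proj, (N e : ℝ) < ε → (N ⟨x, b.modelSection (u 0) x⟩ : ℝ) < ε := by
    by_cases h : (N e : ℝ) < ε
    · have h1 := (hN.continuousOn_modelSection hb u hu).continuousAt
        (b.base.open_source.mem_nhds hxb)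
      have h2 := (NNReal.continuous_coe.continuousAt.comp h1).eventually_lt_const (u := ε)
        (by rw [Function.comp_apply, hmodel]; exact h)
      exact h2.mono fun x hx _ => hx
    · exact Eventually.of_forall fun x h' => absurd h' h
  have hD : ∀ᶠ x in 𝓝 e.proj, x ∈ b.base.φ.source ∩ U ∩ V :=
    ((b.base.open_source.inter hU).inter hV).eventually_mem ⟨⟨hxb, heU⟩, hxV⟩
  obtain ⟨U₀, hU₀sub, hU₀⟩ := G.exists_hasNaturalRep e.proj (hD.and hNe)
  obtain ⟨β, A, hβ, hβ0, hβ1, hβe, hA, hAU₀, hβA⟩ :=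
    b.exists_cutoff (hP b hb).1 (hP b hb).2.1 hxb (hU₀.1.mem_nhds hU₀.2.1)
  let s : ∀ x, Fib x := fun x => β (b.base.φ x) • b.modelSection (u 0) x
  have hUb : U₀ ⊆ b.base.φ.source := fun x hx => (hU₀sub hx).1.1.1
  have hsA : ∀ y ∈ U₀, y ∉ A → s y = 0 := fun y hy hyA => by
    have : β (b.base.φ y) = 0 := by
      by_contra hne; exact hyA (hβA y (hUb hy) hne)
    simp only [s, this, zero_smul]
  have hse : s e.proj = e.snd := by simp only [s, hβe, one_smul, hmodel]
  have hAc := hclosed A (fun y hy => (hU₀sub (hAU₀ hy)).1.2) hA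
  have hfin := fun y => hU₀.finite_outInto y
  refine ⟨P.average U₀ s, isScPlusMultisection_average hU₀ hb hUb
    (BundleChart.isScPlusOn_smul_modelSection u hu hβ) hAU₀ hsA hAc, ?_, ?_, fun hε h hpos => ?_⟩
  · have htriv : TrivialOn (P.average U₀ s) {y : X | ∃ y' ∈ A, Nonempty (y ⟶ y')}ᶜ := fun y hy => by
      rw [P.average_of_forall_eq_zero fun m => hsA _ m.2 fun hm => hy ⟨_, hm, ⟨m.1.2⟩⟩, if_pos rfl]
    have hsub : multisectionSupport (P.average U₀ s) ⊆ {y : X | ∃ y' ∈ A, Nonempty (y ⟶ y')} :=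
      Set.sInter_subset_of_mem ⟨hAc, htriv⟩
    refine hsub.trans ?_
    rintro y ⟨y', hy', ⟨k⟩⟩
    exact hsat (CategoryTheory.Groupoid.inv k) (hU₀sub (hAU₀ hy')).1.1.2
  · have h1 := P.average_pos (s := s) hU₀.2.1
    rw [hse] at h1
    exact h1
  · obtain ⟨y, h⟩ := h
    rcases P.exists_of_average_pos hpos with ⟨m, hm⟩ | rfl
    · have hmb := hUb m.2
      obtain ⟨f, hf, -⟩ := BundleChart.exists_isScSmooth_modelSection u hu
      have h1 : (⟨m.1.1, b.modelSection (u 0) m.1.1⟩ : Tot Fib) ∈ P.E01 :=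
        ⟨b, hb, BundleChart.mem_source hmb _, f (b.base.φ m.1.1), by
          rw [hf _ (b.base.φ.map_source hmb), BundleChart.snd_modelSection _ hmb]⟩
      have h2 : (⟨m.1.1, s m.1.1⟩ : Tot Fib) ∈ P.E01 :=
        ⟨b, hb, BundleChart.mem_source hmb _, β (b.base.φ m.1.1) • f (b.base.φ m.1.1), by
          rw [(b.linear _ hmb).map_smul, map_smul, hf _ (b.base.φ.map_source hmb),
            BundleChart.snd_modelSection _ hmb]⟩
      have h3 : (⟨y, h⟩ : Tot Fib) ∈ P.E01 := by
        have := μ_mem_E01 (CategoryTheory.Groupoid.inv m.1.2) h2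
        rwa [← hm, P.μ_inv_μ] at this
      refine ⟨h3, ?_⟩
      -- By invariance `N h` is the norm of a value of `s`, hence at most that of the model section.
      rw [← hN.invariant m.1.2 h h3, hm, hN.smul _ _ _ h1, NNReal.coe_mul, coe_nnnorm,
        Real.norm_of_nonneg (hβ0 _)]
      exact (mul_le_of_le_one_left NNReal.zero_le_coe (hβ1 _)).trans_lt ((hU₀sub m.2).2 hε)
    · refine ⟨zero_mem_E01 y, ?_⟩
      have h0 := hN.smul y 0 (0 : Fib y) (zero_mem_E01 y)
      rw [smul_zero, nnnorm_zero, zero_mul] at h0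
      rw [h0]
      exact (NNReal.coe_nonneg _).trans_lt hε
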